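/- Let $\mathcal H$ be a real separable Hilbert space with $\dim\mathcal H=\infty$, and let $\mathrm{HS}(\mathcal H)$ be the space of Hilbert–Schmidt operators on $\mathcal H$, with $\langle A,B\rangle_{\mathrm{HS}}=\mathrm{trace}(A^*B)$. Let $\mathrm{HS}_X(\mathcal H)=\{A+\gamma I: A\in\mathrm{HS}(\mathcal H),\ \gamma\in\mathbb R\}$ with inner product $\langle A+\gamma I,B+\mu I\rangle_{\mathrm{HS}_X}=\langle A,B\rangle_{\mathrm{HS}}+\gamma\mu$, let $E=\mathrm{Sym}(\mathcal H)\cap\mathrm{HS}_X(\mathcal H)$ be its subspace of self-adjoint operators, and let $$\mathit{PC}_2(\mathcal H)=\{P\in E:\ \exists M>0\ \ \forall x\in\mathcal H,\ \langle x,Px\rangle\ge M\|x\|^2\},$$ an open subset of $E$. For $P\in\mathit{PC}_2(\mathcal H)$ with orthonormal eigenbasis $(\varphi_k)$ and eigenvalues $\lambda_k>0$ let $\log P=\sum_k\log(\lambda_k)\,\varphi_k\otimes\varphi_k$ be its principal logarithm, and put $P\odot Q=\exp(\log P+\log Q)$. **Theorem.** $E$ is an infinite-dimensional Hilbert space; $\log$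 is well defined from $\mathit{PC}_2(\mathcal H)$ to $E$ and Fréchet differentiable; $\exp$ maps $E$ into $\mathit{PC}_2(\mathcal H)$. For $P\in\mathit{PC}_2(\mathcal H)$ and $U,V\in E$ let $$g(P)(U,V)=\langle D\log(P)(U),D\log(P)(V)\rangle_{\mathrm{HS}_X},$$ where $D\log(P)$ is the Fréchet derivative of $\log$ at $P$. Then: 1. $g(I)=\langle\cdot,\cdot\rangle_{\mathrm{HS}_X}$, and $g$ is invariant under the left and right translations of $(\mathit{PC}_2(\mathcal H),\odot)$. 2. $g$ is a smooth Riemannian metric on the infinite-dimensional Hilbert manifold $\mathit{PC}_2(\mathcal H)$ (each $g(P)$ inducing the topology of $E$). It has a Levi-Civita connection, whose curvature tensor vanishes; in particular all sectional curvatures are zero. 3. For any $A+\gamma I,\ B+\mu I\in\mathit{PC}_2(\mathcal H)$ there is exactly one geodesic parametrized by $[0,1]$ that joins $A+\gamma I$ to $B+\mu I$, namely $$t\mapsto\exp\big((1-t)\log(A+\gamma I)+t\log(B+\mu I)\big).$$ 4. The Riemannian distance between $A+\gamma I$ and $B+\mu I$ (the infimum of the lengths of $C^1$ curves joining them) is the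 length of this geodesic, and equals $\|\log(A+\gamma I)-\log(B+\mu I)\|_{\mathrm{HS}_X}$. -/

import Mathlib

open Set Manifold
open scoped ContDiff RealInnerProductSpace Topology ENNReal

universe u

noncomputable section

namespace LogHS

section HilbertSchmidt

variable {H : Type u} [NormedAddCommGroup H] [InnerProductSpace ℝ H]

/-- `A` is Hilbert-Schmidt: `∑ ‖A eₖ‖² < ∞` for every orthonormal (Hilbert) basis `(eₖ)`. -/
def IsHilbertSchmidt (A : H →L[ℝ] H) : Prop :=
  ∀ ⦃ι : Type u⦄ (e : HilbertBasis ι ℝ H), Summable fun i => ‖A (e i)‖ ^ 2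

theorem enorm_sq_eq_tsum {ι : Type*} (e : HilbertBasis ι ℝ H) (x : H) :
    ‖x‖ₑ ^ 2 = ∑' i, ‖⟪e i, x⟫‖ₑ ^ 2 := by
  have h := e.hasSum_inner_mul_inner x x
  have h2 : HasSum (fun i => ⟪e i, x⟫ ^ 2) (‖x‖ ^ 2) := by
    rw [real_inner_self_eq_norm_sq] at h
    refine h.congr_fun ?_
    intro i
    rw [real_inner_comm (e i) x, sq]
  have h3 := h2.tsum_eq
  have key : ∀ r : ℝ, ‖r‖ₑ ^ 2 = ENNReal.ofReal (r ^ 2) := by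
    intro r
    rw [Real.enorm_eq_ofReal_abs, ← ENNReal.ofReal_pow (abs_nonneg _), sq_abs]
  simp_rw [key]
  rw [← ENNReal.ofReal_tsum_of_nonneg (fun i => sq_nonneg _) h2.summable, h3,
    ENNReal.ofReal_pow (norm_nonneg _), ofReal_norm]

/-- The Hilbert-Schmidt square sum can be computed in one basis or, for the adjoint, in another. -/
theorem tsum_enorm_sq_adjoint [CompleteSpace H] {ι κ : Type*} (e : HilbertBasis ι ℝ H)
    (f : HilbertBasis κ ℝ H) (A : H →L[ℝ] H) :
    ∑' i, ‖A (e i)‖ₑ ^ 2 = ∑' j, ‖A.adjoint (f j)‖ₑ ^ 2 := by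
  simp_rw [enorm_sq_eq_tsum f (A _), enorm_sq_eq_tsum e (A.adjoint _)]
  rw [ENNReal.tsum_comm]
  refine tsum_congr fun j => tsum_congr fun i => ?_
  rw [ContinuousLinearMap.adjoint_inner_right, real_inner_comm]

theorem summable_iff_enorm {E : Type*} [SeminormedAddCommGroup E] {ι : Type*} (v : ι → E) :
    (Summable fun i => ‖v i‖ ^ 2) ↔ ∑' i, ‖v i‖ₑ ^ 2 ≠ ⊤ := by
  have : ∀ i, ‖v i‖ₑ ^ 2 = ((‖v i‖₊ ^ 2 : NNReal) : ℝ≥0∞) := fun i => by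
    rw [enorm_eq_nnnorm]; push_cast; rfl
  simp_rw [this]
  rw [ENNReal.tsum_coe_ne_top_iff_summable, ← NNReal.summable_coe]
  simp

/-- Square summability in one Hilbert basis implies it in every other one. -/
theorem summable_of_basis [CompleteSpace H] {ι κ : Type*} (e : HilbertBasis ι ℝ H)
    (f : HilbertBasis κ ℝ H) {A : H →L[ℝ] H} (h : Summable fun i => ‖A (e i)‖ ^ 2) :
    Summable fun j => ‖A (f j)‖ ^ 2 := by
  rw [summable_iff_enorm] at h ⊢
  rwa [tsum_enorm_sq_adjoint f f, ← tsum_enorm_sq_adjoint e f]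

theorem IsHilbertSchmidt.of_basis [CompleteSpace H] {ι : Type*} (e : HilbertBasis ι ℝ H)
    {A : H →L[ℝ] H} (h : Summable fun i => ‖A (e i)‖ ^ 2) : IsHilbertSchmidt A :=
  fun _ f => summable_of_basis e f h

variable (H) in
/-- A Hilbert basis of `H`, used to write down the Hilbert-Schmidt inner product (the value does not
depend on it, see `HS.inner_eq_tsum`). -/
def stdBasis [CompleteSpace H] :
    HilbertBasis (exists_hilbertBasis ℝ H).choose ℝ H :=
  (exists_hilbertBasis ℝ H).choose_spec.choose

variable (H) in
/-- The linear subspace of Hilbert-Schmidt operators. -/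
def hsSubmodule : Submodule ℝ (H →L[ℝ] H) where
  carrier := {A | IsHilbertSchmidt A}
  zero_mem' := fun ι e => by simp
  add_mem' := by
    intro A B hA hB ι e
    refine Summable.of_nonneg_of_le (fun i => sq_nonneg _) (fun i => ?_)
      (((hA e).mul_left 2).add ((hB e).mul_left 2))
    have h1 : ‖(A + B) (e i)‖ ≤ ‖A (e i)‖ + ‖B (e i)‖ := norm_add_le _ _
    nlinarith [norm_nonneg ((A + B) (e i)), sq_nonneg (‖A (e i)‖ - ‖B (e i)‖)]
  smul_mem' := by
    intro c A hA ι e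
    refine ((hA e).mul_left (‖c‖ ^ 2)).congr fun i => ?_
    simp [norm_smul, mul_pow]

theorem summable_inner_of_sq {ι : Type*} {v w : ι → H} (hv : Summable fun i => ‖v i‖ ^ 2)
    (hw : Summable fun i => ‖w i‖ ^ 2) : Summable fun i => ⟪v i, w i⟫ := by
  refine Summable.of_norm_bounded (hv.add hw) fun i => ?_
  have h := norm_inner_le_norm (𝕜 := ℝ) (v i) (w i)
  nlinarith [sq_nonneg (‖v i‖ - ‖w i‖), sq_nonneg (‖v i‖ + ‖w i‖)]

end HilbertSchmidt

section Spaces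

variable (H : Type u) [NormedAddCommGroup H] [InnerProductSpace ℝ H]

/-- The space `HS(H)` of Hilbert-Schmidt operators (a separate type, because it carries the
Hilbert-Schmidt norm rather than the operator norm). -/
def HS : Type u := hsSubmodule H

instance : AddCommGroup (HS H) := inferInstanceAs (AddCommGroup (hsSubmodule H))
instance : Module ℝ (HS H) := inferInstanceAs (Module ℝ (hsSubmodule H))

/-- The inclusion of `HS(H)` in the bounded operators. -/
def HS.toOp : HS H →ₗ[ℝ] (H →L[ℝ] H) := (hsSubmodule H).subtype

variable {H} in
theorem HS.isHilbertSchmidt (A : HS H) : IsHilbertSchmidt (HS.toOp H A) := A.2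

theorem HS.toOp_injective : Function.Injective (HS.toOp H) := Subtype.val_injective

variable [CompleteSpace H]

/-- The Hilbert-Schmidt inner product `⟪A, B⟫ = trace (A* B) = ∑ ⟪A eₖ, B eₖ⟫`. -/
@[reducible]
def hsCore : InnerProductSpace.Core ℝ (HS H) where
  inner A B := ∑' i, ⟪HS.toOp H A (stdBasis H i), HS.toOp H B (stdBasis H i)⟫
  conj_inner_symm A B := by
    simp only [conj_trivial]
    exact tsum_congr fun i => real_inner_comm _ _
  re_inner_nonneg A := by
    simp only [RCLike.re_to_real]
    exact tsum_nonneg fun i => real_inner_self_nonneg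
  add_left A B C := by
    simp only [map_add, _root_.add_apply, inner_add_left]
    exact Summable.tsum_add
      (summable_inner_of_sq (A.isHilbertSchmidt (stdBasis H)) (C.isHilbertSchmidt (stdBasis H)))
      (summable_inner_of_sq (B.isHilbertSchmidt (stdBasis H)) (C.isHilbertSchmidt (stdBasis H)))
  smul_left A B r := by
    simp only [map_smul, _root_.smul_apply, real_inner_smul_left, conj_trivial]
    exact tsum_mul_left
  definite A hA := by
    have hs := summable_inner_of_sq (A.isHilbertSchmidt (stdBasis H))
      (A.isHilbertSchmidt (stdBasis H))
    have h0 : ∀ i, HS.toOp H A (stdBasis H i) = 0 := fun i => by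
      have := (hasSum_zero_iff_of_nonneg (fun i => real_inner_self_nonneg)).1 (hA ▸ hs.hasSum)
      exact inner_self_eq_zero.1 (congrFun this i)
    apply HS.toOp_injective H
    rw [map_zero]
    ext x
    have hx := ((stdBasis H).hasSum_repr x).mapL (HS.toOp H A)
    simp only [map_smul, h0, smul_zero] at hx
    simpa using hx.unique hasSum_zero

instance : NormedAddCommGroup (HS H) := (hsCore H).toNormedAddCommGroup
instance : InnerProductSpace ℝ (HS H) := InnerProductSpace.ofCore (hsCore H).toCore

variable {H} in
theorem HS.inner_def (A B : HS H) :
    ⟪A, B⟫ = ∑' i, ⟪HS.toOp H A (stdBasis H i), HS.toOp H B (stdBasis H i)⟫ := rfl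


variable {H} in
theorem HS.norm_sq_eq_tsum (A : HS H) {ι : Type*} (e : HilbertBasis ι ℝ H) :
    ‖A‖ ^ 2 = ∑' i, ‖HS.toOp H A (e i)‖ ^ 2 := by
  have h1 : ‖A‖ ^ 2 = ∑' i, ‖HS.toOp H A (stdBasis H i)‖ ^ 2 := by
    rw [← real_inner_self_eq_norm_sq, HS.inner_def]
    simp_rw [real_inner_self_eq_norm_sq]
  rw [h1]
  have key : ∀ {κ : Type _} (f : HilbertBasis κ ℝ H), ENNReal.ofReal
      (∑' i, ‖HS.toOp H A (f i)‖ ^ 2) = ∑' i, ‖HS.toOp H A (f i)‖ₑ ^ 2 := by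
    intro κ f
    rw [ENNReal.ofReal_tsum_of_nonneg (fun i => sq_nonneg _)
      (summable_of_basis (stdBasis H) f (A.isHilbertSchmidt _))]
    simp_rw [ENNReal.ofReal_pow (norm_nonneg _), ofReal_norm]
  have key' : ENNReal.ofReal
      (∑' i, ‖HS.toOp H A (e i)‖ ^ 2) = ∑' i, ‖HS.toOp H A (e i)‖ₑ ^ 2 := by
    rw [ENNReal.ofReal_tsum_of_nonneg (fun i => sq_nonneg _)
      (summable_of_basis (stdBasis H) e (A.isHilbertSchmidt _))]
    simp_rw [ENNReal.ofReal_pow (norm_nonneg _), ofReal_norm]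
  rw [← ENNReal.ofReal_eq_ofReal_iff (tsum_nonneg fun i => sq_nonneg _)
    (tsum_nonneg fun i => sq_nonneg _), key, key',
    tsum_enorm_sq_adjoint (stdBasis H) e, ← tsum_enorm_sq_adjoint e e]

variable {H} in
/-- The Hilbert-Schmidt inner product does not depend on the Hilbert basis. -/
theorem HS.inner_eq_tsum (A B : HS H) {ι : Type*} (e : HilbertBasis ι ℝ H) :
    ⟪A, B⟫ = ∑' i, ⟪HS.toOp H A (e i), HS.toOp H B (e i)⟫ := by
  have hA := summable_of_basis (stdBasis H) e (A.isHilbertSchmidt _)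
  have hB := summable_of_basis (stdBasis H) e (B.isHilbertSchmidt _)
  have hAB := summable_inner_of_sq hA hB
  have h := HS.norm_sq_eq_tsum (A + B) e
  simp only [map_add, _root_.add_apply, norm_add_sq_real] at h
  rw [Summable.tsum_add (hA.add (hAB.mul_left 2)) hB, Summable.tsum_add hA (hAB.mul_left 2),
    tsum_mul_left, ← HS.norm_sq_eq_tsum A e, ← HS.norm_sq_eq_tsum B e] at h
  linarith

variable {H} in
theorem HS.abs_inner_toOp_le (A : HS H) (x : H) :
    |⟪x, HS.toOp H A x⟫| ≤ ‖A‖ * ‖x‖ ^ 2 := by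
  have hA := A.isHilbertSchmidt (stdBasis H)
  set T := HS.toOp H A with hT
  have h1 : ‖T.adjoint x‖ ^ 2 ≤ (‖A‖ * ‖x‖) ^ 2 := by
    have h2 := (stdBasis H).hasSum_inner_mul_inner (T.adjoint x) (T.adjoint x)
    rw [real_inner_self_eq_norm_sq] at h2
    rw [mul_pow, HS.norm_sq_eq_tsum A (stdBasis H), mul_comm, ← tsum_mul_left, ← h2.tsum_eq]
    refine h2.summable.tsum_le_tsum (fun i => ?_) (hA.mul_left (‖x‖ ^ 2))
    rw [ContinuousLinearMap.adjoint_inner_left, ContinuousLinearMap.adjoint_inner_right,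
      real_inner_comm, ← sq, ← mul_pow, ← sq_abs, real_inner_comm]
    exact pow_le_pow_left₀ (abs_nonneg _) (norm_inner_le_norm (𝕜 := ℝ) _ _) 2
  have h3 : ‖T.adjoint x‖ ≤ ‖A‖ * ‖x‖ :=
    (pow_le_pow_iff_left₀ (norm_nonneg _) (by positivity) two_ne_zero).1 h1
  rw [← ContinuousLinearMap.adjoint_inner_left]
  refine (abs_real_inner_le_norm _ _).trans ?_
  nlinarith [norm_nonneg x]

/-- The space `HS_X(H)` of extended Hilbert-Schmidt operators `A + γ I`, as the orthogonal direct
sum of `HS(H)` and the scalars: `⟪A + γ I, B + μ I⟫ = ⟪A, B⟫ + γ μ`. For infinite-dimensional `H`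
the pair `(A, γ)` is determined by the operator `A + γ I`, see `HSX.op_injective`. -/
abbrev HSX : Type u := WithLp 2 (HS H × ℝ)

/-- The operator `A + γ I` that the pair `(A, γ)` stands for. -/
def HSX.op : HSX H →ₗ[ℝ] (H →L[ℝ] H) where
  toFun P := HS.toOp H P.fst + P.snd • 1
  map_add' P Q := by simp [add_smul]; abel
  map_smul' c P := by simp [mul_smul]

theorem HSX.inner_eq (P Q : HSX H) : ⟪P, Q⟫ = ⟪P.fst, Q.fst⟫ + P.snd * Q.snd := by
  rw [WithLp.prod_inner_apply]
  simp [mul_comm]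

theorem HSX.op_injective (hH : ¬ FiniteDimensional ℝ H) : Function.Injective (HSX.op H) := by
  rw [injective_iff_map_eq_zero]
  intro P hP
  have h1 : HS.toOp H P.fst = -(P.snd • (1 : H →L[ℝ] H)) := eq_neg_of_add_eq_zero_left hP
  have hs := P.fst.isHilbertSchmidt (stdBasis H)
  rw [h1] at hs
  have hinf : Infinite (exists_hilbertBasis ℝ H).choose := by
    by_contra hfin
    rw [not_infinite_iff_finite] at hfin
    have := Fintype.ofFinite (exists_hilbertBasis ℝ H).choose
    exact hH (stdBasis H).toOrthonormalBasis.toBasis.finiteDimensional_of_finite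
  have h2 : P.snd = 0 := by
    simp only [_root_.neg_apply, _root_.smul_apply, one_apply_eq_self,
      norm_neg, norm_smul, (stdBasis H).orthonormal.1, mul_one, summable_const_iff] at hs
    simpa using hs
  have h3 : P.fst = 0 := HS.toOp_injective H (by rw [h1, h2]; simp)
  rw [← WithLp.ofLp_eq_zero 2]
  exact Prod.ext h3 h2

/-- `Sym(H) ∩ HS_X(H)`, with the extended Hilbert-Schmidt inner product. -/
def SymHSX : Submodule ℝ (HSX H) where
  carrier := {P | IsSelfAdjoint (HSX.op H P)}
  zero_mem' := by simp
  add_mem' := by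
    intro P Q hP hQ
    simpa using IsSelfAdjoint.add hP hQ
  smul_mem' := by
    intro c P hP
    simpa using IsSelfAdjoint.smul (IsSelfAdjoint.all c) hP

variable {H} in
/-- The operator on `H` underlying an element of `Sym(H) ∩ HS_X(H)`. -/
def symOp (P : SymHSX H) : H →L[ℝ] H := HSX.op H P

variable {H} in
/-- Positive definiteness: `⟪x, P x⟫ ≥ M ‖x‖²` for some `M > 0`. -/
def IsPosDef (P : H →L[ℝ] H) : Prop := ∃ M > 0, ∀ x, M * ‖x‖ ^ 2 ≤ ⟪x, P x⟫

theorem isOpen_posDef : IsOpen {P : SymHSX H | IsPosDef (symOp P)} := by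
  rw [Metric.isOpen_iff]
  rintro P ⟨M, hM, h⟩
  refine ⟨M / 4, by positivity, fun Q hQ => ⟨M / 2, by positivity, fun x => ?_⟩⟩
  rw [Metric.mem_ball, dist_eq_norm] at hQ
  set D : HSX H := ((Q - P : SymHSX H) : HSX H) with hD
  have hDn : ‖D‖ < M / 4 := hQ
  have hsq : ‖D‖ ^ 2 = ‖D.fst‖ ^ 2 + ‖D.snd‖ ^ 2 := by
    exact WithLp.prod_norm_sq_eq_of_L2 D
  have h1 : ‖D.fst‖ ≤ ‖D‖ := by
    refine (pow_le_pow_iff_left₀ (by positivity) (norm_nonneg _) two_ne_zero).1 ?_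
    nlinarith [sq_nonneg ‖D.snd‖]
  have h2 : |D.snd| ≤ ‖D‖ := by
    refine (pow_le_pow_iff_left₀ (by positivity) (norm_nonneg _) two_ne_zero).1 ?_
    rw [← Real.norm_eq_abs]
    nlinarith [sq_nonneg ‖D.fst‖]
  have h3 : ⟪x, (symOp Q) x⟫ = ⟪x, (symOp P) x⟫ + (⟪x, HS.toOp H D.fst x⟫ + D.snd * ‖x‖ ^ 2) := by
    have : (symOp Q) = (symOp P) + HSX.op H D := by
      simp [hD, symOp]
    rw [this, _root_.add_apply, inner_add_right]
    congr 1
    simp [HSX.op, inner_add_right, real_inner_smul_right]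
  have h4 := abs_le.1 (HS.abs_inner_toOp_le D.fst x)
  have h5 := abs_le.1 h2
  have h6 := h x
  rw [h3]
  nlinarith [sq_nonneg ‖x‖]

/-- The manifold `PC₂(H)` of positive definite unitized Hilbert-Schmidt operators, an open subset of
the Hilbert space `Sym(H) ∩ HS_X(H)`; its smooth structure is that of an open subset. -/
def PC2 : TopologicalSpace.Opens (SymHSX H) := ⟨{P | IsPosDef (symOp P)}, isOpen_posDef H⟩

/-- The identity operator, as a point of `PC₂(H)`. -/
def PC2.id : PC2 H :=
  ⟨⟨WithLp.toLp 2 (0, 1), by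
    change IsSelfAdjoint (HSX.op H _)
    simp [HSX.op]⟩, by
    refine ⟨1, one_pos, fun x => ?_⟩
    simp [symOp, HSX.op]⟩

end Spaces

section LogExp

variable {H : Type u} [NormedAddCommGroup H] [InnerProductSpace ℝ H]

/-- `L` is the principal logarithm of `P`: for an orthonormal basis of eigenvectors `φₖ` of `P` with
eigenvalues `lₖ > 0`, `L = ∑ log(lₖ) φₖ ⊗ φₖ`. -/
def IsPrincipalLog (P L : H →L[ℝ] H) : Prop :=
  ∃ (ι : Type u) (φ : HilbertBasis ι ℝ H) (l : ι → ℝ), ∀ k,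
    0 < l k ∧ P (φ k) = l k • φ k ∧ L (φ k) = Real.log (l k) • φ k

variable [CompleteSpace H]

open Classical in
/-- The principal logarithm, as a map into `Sym(H) ∩ HS_X(H)` (with value `0` where there is no such
logarithm). -/
def log (P : SymHSX H) : SymHSX H :=
  if h : ∃ L : SymHSX H, IsPrincipalLog (symOp P) (symOp L) then h.choose else 0

open Classical in
/-- The operator exponential, as a map of `Sym(H) ∩ HS_X(H)` into itself. -/
def exp (L : SymHSX H) : SymHSX H :=
  if h : ∃ P : SymHSX H, (symOp P) = NormedSpace.exp (symOp L) then h.choose else 0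

/-- The commutative group operation `P ⊙ Q = exp (log P + log Q)`. -/
def odot (P Q : SymHSX H) : SymHSX H := exp (log P + log Q)

variable (H) in
/-- `g(P)(U, V) = ⟪D log(P) U, D log(P) V⟫`. -/
def logHSMetric (P : SymHSX H) : SymHSX H →L[ℝ] SymHSX H →L[ℝ] ℝ :=
  (innerSL ℝ).bilinearComp (fderiv ℝ log P) (fderiv ℝ log P)

end LogExp

/-! Riemannian geometry of an open subset `U` of a Hilbert space `E`, in the coordinates of `E`. -/

section Geometry

open scoped Bundle

variable {E : Type*} [NormedAddCommGroup E] [NormedSpace ℝ E]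

/-- `Γ` is the Christoffel map of the Levi-Civita connection `∇_X Y = DY(X) + Γ(X, Y)` of the
Riemannian metric `g` on the open set `U`: smooth, torsion-free, compatible with `g`. -/
structure IsLeviCivita (U : Set E) (g : E → E →L[ℝ] E →L[ℝ] ℝ) (Γ : E → E →L[ℝ] E →L[ℝ] E) :
    Prop where
  smooth : ContDiffOn ℝ ∞ Γ U
  torsion_free : ∀ P ∈ U, ∀ u v, Γ P u v = Γ P v u
  metric : ∀ P ∈ U, ∀ w u v,
    fderiv ℝ (fun Q => g Q u v) P w = g P (Γ P w u) v + g P u (Γ P w v)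

/-- The curvature tensor `R(u, v) w` at `P` of the connection with Christoffel map `Γ`. -/
def curvature (Γ : E → E →L[ℝ] E →L[ℝ] E) (P u v w : E) : E :=
  fderiv ℝ Γ P u v w - fderiv ℝ Γ P v u w + Γ P u (Γ P v w) - Γ P v (Γ P u w)

/-- The sectional curvature at `P` of the plane spanned by linearly independent `u`, `v`. -/
def sectionalCurvature (g : E → E →L[ℝ] E →L[ℝ] ℝ) (Γ : E → E →L[ℝ] E →L[ℝ] E) (P u v : E) : ℝ :=
  g P (curvature Γ P u v v) u / (g P u u * g P v v - g P u v ^ 2)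

/-- `c`, restricted to `[0, 1]`, is a geodesic: `c'' + Γ(c)(c', c') = 0`. -/
def IsGeodesic (Γ : E → E →L[ℝ] E →L[ℝ] E) (c : ℝ → E) : Prop :=
  ∃ v : ℝ → E, ∀ t ∈ Icc (0 : ℝ) 1, HasDerivWithinAt c (v t) (Icc 0 1) t ∧
    HasDerivWithinAt v (-(Γ (c t) (v t) (v t))) (Icc 0 1) t

/-- Smooth Riemannian metrics on the open subset `U` of `E`, as a manifold. -/
abbrev SmoothMetric (U : TopologicalSpace.Opens E) :=
  Bundle.ContMDiffRiemannianMetric 𝓘(ℝ, E) ∞ E (fun P : U => TangentSpace 𝓘(ℝ, E) P)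

variable {U : TopologicalSpace.Opens E}

/-- The Riemannian distance: the infimum of the lengths of `C¹` curves in `U` from `P` to `Q`. -/
def SmoothMetric.dist (G : SmoothMetric U) (P Q : U) : ℝ≥0∞ :=
  letI : Bundle.RiemannianBundle (fun P : U => TangentSpace 𝓘(ℝ, E) P) := ⟨G.toRiemannianMetric⟩
  riemannianEDist 𝓘(ℝ, E) P Q

/-- The length of the curve `c` restricted to `[0, 1]`. -/
def SmoothMetric.length (G : SmoothMetric U) (c : ℝ → U) : ℝ≥0∞ :=
  letI : Bundle.RiemannianBundle (fun P : U => TangentSpace 𝓘(ℝ, E) P) := ⟨G.toRiemannianMetric⟩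
  pathELength 𝓘(ℝ, E) c 0 1

end Geometry

end LogHS

end

/-! The logarithm is a diffeomorphism of PC₂(H) onto the whole Hilbert space E, with inverse exp,
and g is the pullback of the constant inner product of E. Hence (PC₂(H), g) is isometric to a flat
Hilbert space: the connection is the trivial one of E, geodesics are the images under exp of affine
segments, the distance is the norm distance of logarithms, and ⊙ is the addition of E, whose
translations are isometries. This transfer only needs a `FlatChart`, with Christoffel map Γ = (D
log)⁻¹ ∘ D² log.

The analytic content is `flatChart`. Smoothness of exp for the Hilbert-Schmidt norm holds because
composition is a bounded bilinear product on HS_X(H): exp X is the exponential of left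
multiplication by X, taken in a Banach algebra, applied to I. That log and exp are mutually inverse
is read off eigenbases, which exist because the Hilbert-Schmidt part is compact and self-adjoint
(`HS.exists_eigenbasis`, `IsPrincipalLog.unique`). That log P stays in E rests on
`HSX.le_snd_of_forall_le_inner`: in infinite dimension the scalar part of a positive definite A + γI
is itself positive.

Smoothness of log comes from the inverse function theorem once D exp(L) is bijective
(`bijective_fderiv_exp`). Differentiating exp(2L) = exp(L)² expresses D exp(2L) through D exp(L) and
the Lyapunov operator V ↦ PV + VP with P = exp L, which is invertible by Lax–Milgram. Bijectivity
therefore spreads by doubling from a neighbourhood of 0, where D exp is close to the identity, to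
all of E. -/

noncomputable section

namespace LogHS

/-! ### Connection, curvature and geodesics in a flat chart -/

section FlatChart

variable {E : Type*} [NormedAddCommGroup E] [InnerProductSpace ℝ E]

/-- A global smooth chart `lg` of the open set `U` onto the whole space, with smooth inverse `ex`. -/
structure FlatChart (U : TopologicalSpace.Opens E) (lg ex : E → E) : Prop where
  contDiffOn : ContDiffOn ℝ ∞ lg U
  contDiff : ContDiff ℝ ∞ ex
  mem : ∀ x, ex x ∈ U
  left_inv : ∀ x, lg (ex x) = x
  right_inv : ∀ P ∈ U, ex (lg P) = P

/-- The pullback of the inner product of `E` by `lg`. -/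
def pullbackMetric (lg : E → E) (P : E) : E →L[ℝ] E →L[ℝ] ℝ :=
  (innerSL ℝ).bilinearComp (fderiv ℝ lg P) (fderiv ℝ lg P)

/-- The Christoffel map of the connection for which `lg` is an affine chart. -/
def pullbackChristoffel (lg ex : E → E) (P : E) : E →L[ℝ] E →L[ℝ] E :=
  (ContinuousLinearMap.compL ℝ E E E (fderiv ℝ ex (lg P))) ∘L (fderiv ℝ (fderiv ℝ lg) P)

theorem pullbackMetric_apply (lg : E → E) (P u v : E) :
    pullbackMetric lg P u v = ⟪fderiv ℝ lg P u, fderiv ℝ lg P v⟫ := rfl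

theorem pullbackChristoffel_apply (lg ex : E → E) (P u v : E) :
    pullbackChristoffel lg ex P u v = fderiv ℝ ex (lg P) (fderiv ℝ (fderiv ℝ lg) P u v) := rfl

namespace FlatChart

variable {U : TopologicalSpace.Opens E} {lg ex : E → E} (h : FlatChart U lg ex)
include h

theorem contDiffAt {P : E} (hP : P ∈ U) : ContDiffAt ℝ ∞ lg P :=
  h.contDiffOn.contDiffAt (U.isOpen.mem_nhds hP)

theorem hasFDerivAt {P : E} (hP : P ∈ U) : HasFDerivAt lg (fderiv ℝ lg P) P :=
  ((h.contDiffAt hP).differentiableAt (by simp)).hasFDerivAt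

theorem hasFDerivAt_ex (x : E) : HasFDerivAt ex (fderiv ℝ ex x) x :=
  (h.contDiff.differentiable (by simp) x).hasFDerivAt

theorem contDiffOn_fderiv : ContDiffOn ℝ ∞ (fderiv ℝ lg) U :=
  h.contDiffOn.fderiv_of_isOpen U.isOpen (by simp)

theorem contDiffOn_fderiv_fderiv : ContDiffOn ℝ ∞ (fderiv ℝ (fderiv ℝ lg)) U :=
  h.contDiffOn_fderiv.fderiv_of_isOpen U.isOpen (by simp)

theorem hasFDerivAt_fderiv {P : E} (hP : P ∈ U) :
    HasFDerivAt (fderiv ℝ lg) (fderiv ℝ (fderiv ℝ lg) P) P :=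
  ((h.contDiffOn_fderiv.contDiffAt (U.isOpen.mem_nhds hP)).differentiableAt (by simp)).hasFDerivAt

theorem hasFDerivAt_fderiv_fderiv {P : E} (hP : P ∈ U) :
    HasFDerivAt (fderiv ℝ (fderiv ℝ lg)) (fderiv ℝ (fderiv ℝ (fderiv ℝ lg)) P) P :=
  ((h.contDiffOn_fderiv_fderiv.contDiffAt (U.isOpen.mem_nhds hP)).differentiableAt
    (by simp)).hasFDerivAt

theorem fderiv_lg_fderiv_ex {P : E} (hP : P ∈ U) (x : E) :
    fderiv ℝ lg P (fderiv ℝ ex (lg P) x) = x := by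
  have h1 : HasFDerivAt lg (fderiv ℝ lg P) (ex (lg P)) := by
    rw [h.right_inv P hP]; exact h.hasFDerivAt hP
  have h2 := h1.comp (lg P) (h.hasFDerivAt_ex (lg P))
  have h3 : lg ∘ ex = id := funext h.left_inv
  rw [h3] at h2
  exact DFunLike.congr_fun (h2.unique (hasFDerivAt_id _)) x

theorem fderiv_ex_fderiv_lg {P : E} (hP : P ∈ U) (x : E) :
    fderiv ℝ ex (lg P) (fderiv ℝ lg P x) = x := by
  have h2 := (h.hasFDerivAt_ex (lg P)).comp P (h.hasFDerivAt hP)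
  have h3 : ex ∘ lg =ᶠ[𝓝 P] id := by
    filter_upwards [U.isOpen.mem_nhds hP] with Q hQ using h.right_inv Q hQ
  exact DFunLike.congr_fun (h2.unique ((hasFDerivAt_id P).congr_of_eventuallyEq h3)) x

theorem fderiv_lg_injective {P : E} (hP : P ∈ U) : Function.Injective (fderiv ℝ lg P) :=
  Function.LeftInverse.injective (g := fderiv ℝ ex (lg P)) (h.fderiv_ex_fderiv_lg hP)

theorem fderiv_fderiv_symm {P : E} (hP : P ∈ U) (u v : E) :
    fderiv ℝ (fderiv ℝ lg) P u v = fderiv ℝ (fderiv ℝ lg) P v u :=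
  (h.contDiffAt hP).isSymmSndFDerivAt (by simp; exact WithTop.coe_le_coe.2 le_top) u v

theorem contDiffOn_christoffel : ContDiffOn ℝ ∞ (pullbackChristoffel lg ex) U := by
  have h1 : ContDiff ℝ ∞ (fderiv ℝ ex) := h.contDiff.fderiv_right (by simp)
  have h2 : ContDiffOn ℝ ∞ (fun P => fderiv ℝ ex (lg P)) U := h1.comp_contDiffOn h.contDiffOn
  have h3 : ContDiffOn ℝ ∞ (fun P => ContinuousLinearMap.compL ℝ E E E (fderiv ℝ ex (lg P))) U :=
    (ContinuousLinearMap.contDiff _).comp_contDiffOn h2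
  exact h3.clm_comp h.contDiffOn_fderiv_fderiv

/-- This is what makes the connection trivial in the chart: D lg (Dv + Γ(·, v)) is the ordinary
derivative of D lg (v). The identities below are checked after applying the injective map D lg. -/
theorem fderiv_lg_christoffel {P : E} (hP : P ∈ U) (u v : E) :
    fderiv ℝ lg P (pullbackChristoffel lg ex P u v) = fderiv ℝ (fderiv ℝ lg) P u v := by
  rw [pullbackChristoffel_apply, h.fderiv_lg_fderiv_ex hP]

theorem isLeviCivita : IsLeviCivita U (pullbackMetric lg) (pullbackChristoffel lg ex) where
  smooth := h.contDiffOn_christoffel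
  torsion_free P hP u v := by
    rw [pullbackChristoffel_apply, pullbackChristoffel_apply, h.fderiv_fderiv_symm hP]
  metric P hP w u v := by
    have hd := h.hasFDerivAt_fderiv hP
    have hu := hd.clm_apply (hasFDerivAt_const u P)
    have hv := hd.clm_apply (hasFDerivAt_const v P)
    have := (hu.inner ℝ hv).fderiv
    simp only [pullbackMetric_apply]
    rw [this, h.fderiv_lg_christoffel hP, h.fderiv_lg_christoffel hP]
    simp [add_comm]

/-- Differentiating D lg (Γ(v, w)) = D² lg (v, w) along u gives D lg (DΓ(u)(v, w) + Γ(u, Γ(v, w))) =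
D³ lg (u, v, w). The right side is symmetric in u and v, and the curvature is the antisymmetrization
of the argument of D lg. -/
theorem curvature_eq_zero {P : E} (hP : P ∈ U) (u v w : E) :
    curvature (pullbackChristoffel lg ex) P u v w = 0 := by
  have hΓ : HasFDerivAt (pullbackChristoffel lg ex) (fderiv ℝ (pullbackChristoffel lg ex) P) P :=
    ((h.contDiffOn_christoffel.contDiffAt (U.isOpen.mem_nhds hP)).differentiableAt
      (by simp)).hasFDerivAt
  have key : ∀ u v, fderiv ℝ lg P (fderiv ℝ (pullbackChristoffel lg ex) P u v w +
      pullbackChristoffel lg ex P u (pullbackChristoffel lg ex P v w)) =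
      fderiv ℝ (fderiv ℝ (fderiv ℝ lg)) P u v w := by
    intro u v
    have h1 := (h.hasFDerivAt_fderiv hP).clm_apply
      ((hΓ.clm_apply (hasFDerivAt_const v P)).clm_apply (hasFDerivAt_const w P))
    have h2 := ((h.hasFDerivAt_fderiv_fderiv hP).clm_apply (hasFDerivAt_const v P)).clm_apply
      (hasFDerivAt_const w P)
    have h3 : (fun Q => fderiv ℝ lg Q (pullbackChristoffel lg ex Q v w)) =ᶠ[𝓝 P]
        fun Q => fderiv ℝ (fderiv ℝ lg) Q v w := by
      filter_upwards [U.isOpen.mem_nhds hP] with Q hQ using h.fderiv_lg_christoffel hQ v w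
    have h4 := DFunLike.congr_fun (h1.unique (h2.congr_of_eventuallyEq h3)) u
    rw [map_add, h.fderiv_lg_christoffel hP]
    simpa using h4
  have hsymm : fderiv ℝ (fderiv ℝ (fderiv ℝ lg)) P u v w =
      fderiv ℝ (fderiv ℝ (fderiv ℝ lg)) P v u w := by
    have := (h.contDiffOn_fderiv.contDiffAt (U.isOpen.mem_nhds hP)).isSymmSndFDerivAt
      (by simp; exact WithTop.coe_le_coe.2 le_top) u v
    rw [this]
  have h5 := h.fderiv_lg_injective hP ((key u v).trans (hsymm.trans (key v u).symm))
  rw [curvature]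
  rw [add_sub_right_comm, ← sub_eq_zero.2 h5]
  abel

omit h in
/-- A curve with vanishing second derivative on `[0, 1]` is a segment. -/
theorem eq_segment_of_deriv_deriv_eq_zero {γ w : ℝ → E}
    (hγ : ∀ t ∈ Icc (0 : ℝ) 1, HasDerivWithinAt γ (w t) (Icc 0 1) t)
    (hw : ∀ t ∈ Icc (0 : ℝ) 1, HasDerivWithinAt w 0 (Icc 0 1) t) :
    ∀ t ∈ Icc (0 : ℝ) 1, γ t = (1 - t) • γ 0 + t • γ 1 := by
  have hconst : ∀ (f : ℝ → E), (∀ t ∈ Icc (0 : ℝ) 1, HasDerivWithinAt f 0 (Icc 0 1) t) →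
      ∀ t ∈ Icc (0 : ℝ) 1, f t = f 0 := by
    intro f hf
    refine constant_of_has_deriv_right_zero (fun t ht => (hf t ht).continuousWithinAt) ?_
    intro t ht
    exact ((hf t (Ico_subset_Icc_self ht)).mono (Icc_subset_Icc_left ht.1)).mono_of_mem_nhdsWithin
      (Icc_mem_nhdsGE ht.2)
  have hw' := hconst w hw
  have h2 := hconst (fun t => γ t - t • w 0) (fun t ht => by
    have := (hγ t ht).sub ((hasDerivWithinAt_id t (Icc 0 1)).smul_const (w 0))
    rw [hw' t ht] at this
    simp only [one_smul, sub_self] at this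
    exact this)
  intro t ht
  have h3 := h2 t ht
  have h4 := h2 1 ⟨zero_le_one, le_rfl⟩
  simp only [zero_smul, sub_zero, one_smul] at h3 h4
  have h5 : γ t = γ 0 + t • w 0 := by rw [← h3]; abel
  have h6 : w 0 = γ 1 - γ 0 := by rw [← h4]; abel
  rw [h5, h6]
  module

/-- Along c = ex ∘ l the vector D lg(c) c' is the constant d. Its derivative is D lg(c) applied to
c'' + Γ(c', c'), which must vanish since D lg(c) is injective. -/
theorem isGeodesic_of_hasDerivAt_const {l : ℝ → E} {d : E} (hl : ∀ t, HasDerivAt l d t) :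
    IsGeodesic (pullbackChristoffel lg ex) (fun t => ex (l t)) := by
  have hc : ∀ t, HasDerivAt (fun t => ex (l t)) (fderiv ℝ ex (l t) d) t := fun t =>
    (h.hasFDerivAt_ex (l t)).comp_hasDerivAt t (hl t)
  have hs : ContDiff ℝ ∞ (fderiv ℝ ex) := h.contDiff.fderiv_right (by simp)
  have hd : Differentiable ℝ (fderiv ℝ ex) := hs.differentiable (by simp)
  refine ⟨fun t => fderiv ℝ ex (l t) d, fun t _ => ⟨(hc t).hasDerivWithinAt, ?_⟩⟩
  have hv : HasDerivAt (fun t => fderiv ℝ ex (l t) d) (fderiv ℝ (fderiv ℝ ex) (l t) d d) t := by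
    have := ((hd (l t)).hasFDerivAt.comp_hasDerivAt t (hl t)).clm_apply (hasDerivAt_const t d)
    rwa [map_zero, add_zero] at this
  have h0 : HasDerivAt (fun s => fderiv ℝ lg (ex (l s)))
      (fderiv ℝ (fderiv ℝ lg) (ex (l t)) (fderiv ℝ ex (l t) d)) t :=
    (h.hasFDerivAt_fderiv (h.mem (l t))).comp_hasDerivAt t (hc t)
  have h1 := h0.clm_apply hv
  have h2 : (fun s => fderiv ℝ lg (ex (l s)) (fderiv ℝ ex (l s) d)) = fun _ => d := by
    funext s
    have := h.fderiv_lg_fderiv_ex (h.mem (l s)) d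
    rwa [h.left_inv] at this
  rw [h2, ← h.fderiv_lg_christoffel (h.mem (l t)), ← map_add] at h1
  have h3 := h.fderiv_lg_injective (h.mem (l t)) ((h1.unique (hasDerivAt_const t _)).trans
    (map_zero _).symm)
  have h4 := eq_neg_of_add_eq_zero_right h3
  have h5 := hv.hasDerivWithinAt (s := Icc 0 1)
  rw [h4] at h5
  exact h5

theorem isGeodesic_segment (a b : E) :
    IsGeodesic (pullbackChristoffel lg ex) (fun t => ex ((1 - t) • a + t • b)) := by
  refine h.isGeodesic_of_hasDerivAt_const (d := b - a) fun t => ?_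
  have := (((hasDerivAt_id t).const_sub 1).smul_const a).add ((hasDerivAt_id t).smul_const b)
  simp only [neg_smul, one_smul] at this
  rw [sub_eq_neg_add]
  exact this

/-- The geodesic equation says exactly that the second derivative of lg ∘ c vanishes on [0, 1]. -/
theorem eqOn_segment_of_isGeodesic {c : ℝ → E} (hc : ∀ t ∈ Icc (0 : ℝ) 1, c t ∈ U)
    (hgeo : IsGeodesic (pullbackChristoffel lg ex) c) :
    ∀ t ∈ Icc (0 : ℝ) 1, c t = ex ((1 - t) • lg (c 0) + t • lg (c 1)) := by
  obtain ⟨v, hv⟩ := hgeo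
  have h1 : ∀ t ∈ Icc (0 : ℝ) 1,
      HasDerivWithinAt (lg ∘ c) (fderiv ℝ lg (c t) (v t)) (Icc 0 1) t := fun t ht =>
    (h.hasFDerivAt (hc t ht)).comp_hasDerivWithinAt t (hv t ht).1
  have h2 : ∀ t ∈ Icc (0 : ℝ) 1,
      HasDerivWithinAt (fun t => fderiv ℝ lg (c t) (v t)) 0 (Icc 0 1) t := fun t ht => by
    have h3 := ((h.hasFDerivAt_fderiv (hc t ht)).comp_hasDerivWithinAt t (hv t ht).1).clm_apply
      (hv t ht).2
    rw [map_neg, Function.comp_apply, h.fderiv_lg_christoffel (hc t ht), add_neg_cancel] at h3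
    exact h3
  intro t ht
  have h3 := eq_segment_of_deriv_deriv_eq_zero h1 h2 t ht
  simp only [Function.comp_apply] at h3
  rw [← h3, h.right_inv _ (hc t ht)]

end FlatChart

end FlatChart

/-! ### Tangent bundle of an open subset of a normed space -/

section OpenSubmanifold

variable {E : Type*} [NormedAddCommGroup E] [NormedSpace ℝ E] {U : TopologicalSpace.Opens E}

theorem extChartAt_opens_apply (P Q : U) : extChartAt 𝓘(ℝ, E) P Q = (Q : E) := rfl

theorem extChartAt_opens_symm_apply (P : U) {x : E} (hx : x ∈ U) :
    (extChartAt 𝓘(ℝ, E) P).symm x = ⟨x, hx⟩ := by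
  have h1 : (⟨x, hx⟩ : U) ∈ (extChartAt 𝓘(ℝ, E) P).source := by
    rw [extChartAt_source, TopologicalSpace.Opens.chartAt_eq,
      OpenPartialHomeomorph.subtypeRestr_source, chartAt_self_eq]
    exact mem_univ _
  exact (extChartAt 𝓘(ℝ, E) P).left_inv h1

omit [NormedSpace ℝ E] in
theorem mem_chartAt_opens_source (P Q : U) : Q ∈ (chartAt E P).source := by
  rw [TopologicalSpace.Opens.chartAt_eq, OpenPartialHomeomorph.subtypeRestr_source,
    chartAt_self_eq]
  exact mem_univ _

/-- Every chart of `U` is the inclusion, so each transition map is the identity near `R`. -/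
theorem tangentCoordChange_opens (P Q R : U) :
    (tangentBundleCore 𝓘(ℝ, E) U).coordChange (achart E P) (achart E Q) R =
      ContinuousLinearMap.id ℝ E := by
  rw [tangentBundleCore_coordChange_achart]
  simp only [modelWithCornersSelf_coe, range_id, fderivWithin_univ, extChartAt_opens_apply]
  have : (extChartAt 𝓘(ℝ, E) Q ∘ (extChartAt 𝓘(ℝ, E) P).symm) =ᶠ[𝓝 (R : E)] id := by
    filter_upwards [U.isOpen.mem_nhds R.2] with x hx
    rw [Function.comp_apply, extChartAt_opens_symm_apply P hx, extChartAt_opens_apply, id]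
  rw [this.fderiv_eq, fderiv_id]

theorem hasMFDerivAt_subtype_val (P : U) :
    HasMFDerivAt 𝓘(ℝ, E) 𝓘(ℝ, E) (Subtype.val : U → E) P (ContinuousLinearMap.id ℝ E) := by
  refine ⟨continuous_subtype_val.continuousAt, ?_⟩
  have : writtenInExtChartAt 𝓘(ℝ, E) 𝓘(ℝ, E) P (Subtype.val : U → E) =ᶠ[𝓝 (P : E)] id := by
    filter_upwards [U.isOpen.mem_nhds P.2] with x hx
    simp only [writtenInExtChartAt, Function.comp_apply]
    rw [extChartAt_opens_symm_apply P hx]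
    rfl
  have h2 : HasFDerivAt (writtenInExtChartAt 𝓘(ℝ, E) 𝓘(ℝ, E) P (Subtype.val : U → E))
      (ContinuousLinearMap.id ℝ E) (P : E) := (hasFDerivAt_id _).congr_of_eventuallyEq this
  exact h2.hasFDerivWithinAt

/-- A field of bilinear forms on an open subset of a normed space is smooth as a section if it is
smooth in the coordinates of the space. -/
theorem contMDiff_bilinear_section {n : ℕ∞ω} {g : E → E →L[ℝ] E →L[ℝ] ℝ}
    (hg : ContDiffOn ℝ n g U)
    (s : ∀ P : U, TangentSpace 𝓘(ℝ, E) P →L[ℝ] TangentSpace 𝓘(ℝ, E) P →L[ℝ] ℝ)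
    (hs : ∀ (P : U) (v w : E), s P v w = g P v w) :
    ContMDiff 𝓘(ℝ, E) (𝓘(ℝ, E).prod 𝓘(ℝ, E →L[ℝ] E →L[ℝ] ℝ)) n
      (fun P : U => Bundle.TotalSpace.mk' (E →L[ℝ] E →L[ℝ] ℝ)
        (E := fun P : U => TangentSpace 𝓘(ℝ, E) P →L[ℝ] TangentSpace 𝓘(ℝ, E) P →L[ℝ] ℝ)
        P (s P)) := by
  intro P
  rw [Bundle.contMDiffAt_section]
  have h1 : ContMDiffAt 𝓘(ℝ, E) 𝓘(ℝ, E →L[ℝ] E →L[ℝ] ℝ) n (fun Q : U => g Q) P :=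
    (hg.contMDiffOn.contMDiffAt (U.isOpen.mem_nhds P.2)).comp P
      contMDiff_subtype_val.contMDiffAt
  convert! h1 using 1
  ext Q v w
  -- The local trivializations are identities, so the section in coordinates is `g` itself.
  have h2 : (trivializationAt E (fun P : U => TangentSpace 𝓘(ℝ, E) P) P).symmL ℝ Q =
      ContinuousLinearMap.id ℝ E := by
    rw [TangentBundle.symmL_trivializationAt_eq_core (mem_chartAt_opens_source P Q)]
    exact tangentCoordChange_opens P Q Q
  have h4 : Q ∈ (trivializationAt E (fun P : U => TangentSpace 𝓘(ℝ, E) P) P).baseSet :=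
    mem_chartAt_opens_source P Q
  have h3 : ∀ v : E, (trivializationAt E (fun P : U => TangentSpace 𝓘(ℝ, E) P) P).symm Q v = v :=
    fun v => (Bundle.Trivialization.symmL_apply (hb := h4) ..).symm.trans (DFunLike.congr_fun h2 v)
  rw [← hs]
  refine (inCoordinates_apply_eq₂ (E₃ := Bundle.Trivial U ℝ) h4 h4 (mem_univ Q)).trans ?_
  rw [h3, h3]
  simp

end OpenSubmanifold

/-! ### The pulled-back Riemannian metric: lengths, distance, isometries -/

section PullbackMetric

variable {E : Type*} [NormedAddCommGroup E] [InnerProductSpace ℝ E]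
  {U : TopologicalSpace.Opens E} {lg ex : E → E}

open scoped Bundle

namespace FlatChart

theorem pullbackMetric_comm (lg : E → E) (P u v : E) :
    pullbackMetric lg P u v = pullbackMetric lg P v u := real_inner_comm _ _

theorem pullbackMetric_self_pos (h : FlatChart U lg ex) {P : E} (hP : P ∈ U) {v : E} (hv : v ≠ 0) :
    0 < pullbackMetric lg P v v :=
  real_inner_self_pos.2 fun h0 => hv (h.fderiv_lg_injective hP (h0.trans (map_zero _).symm))

/-- The bounded left inverse D ex of D lg controls ‖v‖ by the metric norm of v, so the metric
induces the topology of `E`. The summand 1 in the radius makes the inequality strict even if D ex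
vanishes. -/
theorem isVonNBounded_pullbackMetric (h : FlatChart U lg ex) {P : E} (hP : P ∈ U) :
    Bornology.IsVonNBounded ℝ {v : E | pullbackMetric lg P v v < 1} := by
  refine (NormedSpace.isVonNBounded_ball ℝ E (‖fderiv ℝ ex (lg P)‖ + 1)).subset fun v hv => ?_
  rw [mem_ofPred_eq, pullbackMetric_apply, real_inner_self_eq_norm_sq,
    sq_lt_one_iff₀ (norm_nonneg _)] at hv
  rw [mem_ball_zero_iff, ← h.fderiv_ex_fderiv_lg hP v]
  have := (fderiv ℝ ex (lg P)).le_opNorm (fderiv ℝ lg P v)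
  nlinarith [norm_nonneg (fderiv ℝ ex (lg P)), norm_nonneg (fderiv ℝ lg P v)]

/-- The pullback of the flat metric as a smooth Riemannian metric on the manifold `U`. -/
def smoothMetric (h : FlatChart U lg ex) : SmoothMetric U where
  inner P := (pullbackMetric lg (P : E) : E →L[ℝ] E →L[ℝ] ℝ)
  symm P v w := pullbackMetric_comm lg P v w
  pos P v hv := h.pullbackMetric_self_pos P.2 hv
  isVonNBounded P := by
    change Bornology.IsVonNBounded ℝ {v : E | pullbackMetric lg P v v < 1}
    exact h.isVonNBounded_pullbackMetric P.2
  contMDiff := by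
    refine contMDiff_bilinear_section (g := pullbackMetric lg) ?_ _ fun P v w => rfl
    have h1 := h.contDiffOn_fderiv
    have h2 : ContDiff ℝ ∞ fun L : E →L[ℝ] E => (innerSL ℝ : E →L[ℝ] E →L[ℝ] ℝ).bilinearComp L L := by
      -- Rewritten through compositions depending smoothly on `L`, in a form that `fun_prop` can
      -- process.
      have h3 : (fun L : E →L[ℝ] E => (innerSL ℝ : E →L[ℝ] E →L[ℝ] ℝ).bilinearComp L L) =
          fun L => ((ContinuousLinearMap.compL ℝ E E ℝ).flip L) ∘L ((innerSL ℝ : E →L[ℝ] E →L[ℝ] ℝ) ∘L L) := by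
        rfl
      rw [h3]
      fun_prop
    exact h2.comp_contDiffOn h1

variable (h : FlatChart U lg ex)
include h

theorem enorm_smoothMetric (P : U) (v : E) :
    letI : Bundle.RiemannianBundle (fun P : U => TangentSpace 𝓘(ℝ, E) P) :=
      ⟨h.smoothMetric.toRiemannianMetric⟩
    ‖(show TangentSpace 𝓘(ℝ, E) P from v)‖ₑ = ‖fderiv ℝ lg P v‖ₑ := by
  let _ : Bundle.RiemannianBundle (fun P : U => TangentSpace 𝓘(ℝ, E) P) :=
      ⟨h.smoothMetric.toRiemannianMetric⟩
  rw [← ofReal_norm, ← ofReal_norm, norm_eq_sqrt_real_inner, norm_eq_sqrt_real_inner]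
  rfl

/-- By the chain rule the metric speed of `γ` is the speed of lg ∘ γ in `E`. -/
theorem length_eq {γ : ℝ → U} (hγ : ContMDiffOn 𝓘(ℝ, ℝ) 𝓘(ℝ, E) 1 γ (Icc 0 1)) :
    h.smoothMetric.length γ =
      ∫⁻ t in Icc (0 : ℝ) 1, ‖derivWithin (fun t => lg (γ t)) (Icc 0 1) t‖ₑ := by
  let _ : Bundle.RiemannianBundle (fun P : U => TangentSpace 𝓘(ℝ, E) P) :=
      ⟨h.smoothMetric.toRiemannianMetric⟩
  change pathELength 𝓘(ℝ, E) γ 0 1 = _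
  rw [pathELength_eq_lintegral_mfderivWithin_Icc]
  refine MeasureTheory.setLIntegral_congr_fun measurableSet_Icc fun t ht => ?_
  have h1 := ((hγ t ht).mdifferentiableWithinAt one_ne_zero).hasMFDerivWithinAt
  have h2 := (hasMFDerivAt_subtype_val (γ t)).comp_hasMFDerivWithinAt t h1
  have h3 : HasFDerivWithinAt (Subtype.val ∘ γ)
    (mfderivWithin 𝓘(ℝ, ℝ) 𝓘(ℝ, E) γ (Icc 0 1) t : ℝ →L[ℝ] E) (Icc 0 1) t :=
      hasMFDerivWithinAt_iff_hasFDerivWithinAt.1 h2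
  have h4 := (h.hasFDerivAt (γ t).2).comp_hasFDerivWithinAt t h3
  have h5 := h4.hasDerivWithinAt.derivWithin (uniqueDiffOn_Icc zero_lt_one t ht)
  exact (h.enorm_smoothMetric (γ t) _).trans (congrArg _ h5.symm)

theorem contDiffOn_lg_comp {γ : ℝ → U} (hγ : ContMDiffOn 𝓘(ℝ, ℝ) 𝓘(ℝ, E) 1 γ (Icc 0 1)) :
    ContDiffOn ℝ 1 (fun t => lg (γ t)) (Icc 0 1) := by
  have h1 : ContMDiffOn 𝓘(ℝ, ℝ) 𝓘(ℝ, E) 1 (fun t => (γ t : E)) (Icc 0 1) :=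
    contMDiff_subtype_val.comp_contMDiffOn hγ
  exact (h.contDiffOn.of_le (WithTop.coe_le_coe.2 le_top)).comp (contMDiffOn_iff_contDiffOn.1 h1)
    fun t _ => (γ t).2

/-- The curve `t ↦ ex ((1 - t) a + t b)` in `U`. -/
def segment (a b : E) (t : ℝ) : U := ⟨ex ((1 - t) • a + t • b), h.mem _⟩

theorem contMDiff_segment (a b : E) : ContMDiff 𝓘(ℝ, ℝ) 𝓘(ℝ, E) ∞ (h.segment a b) := by
  rw [← ContMDiff.subtypeVal_comp_iff, contMDiff_iff_contDiff]
  refine h.contDiff.comp ?_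
  fun_prop

theorem length_segment (a b : E) :
    h.smoothMetric.length (h.segment a b) = ENNReal.ofReal ‖a - b‖ := by
  rw [h.length_eq (((h.contMDiff_segment a b).of_le (WithTop.coe_le_coe.2 le_top)).contMDiffOn)]
  have h1 : (fun t => lg (h.segment a b t : E)) = fun t => (1 - t) • a + t • b :=
    funext fun t => h.left_inv _
  have h2 : ∀ t ∈ Icc (0 : ℝ) 1,
      ‖derivWithin (fun t => lg (h.segment a b t : E)) (Icc 0 1) t‖ₑ = ‖b - a‖ₑ := fun t ht => by
    have := (((hasDerivAt_id t).const_sub 1).smul_const a).add ((hasDerivAt_id t).smul_const b)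
    simp only [neg_smul, one_smul] at this
    rw [← sub_eq_neg_add] at this
    rw [h1]
    exact congrArg _ (this.hasDerivWithinAt.derivWithin (uniqueDiffOn_Icc zero_lt_one t ht))
  rw [MeasureTheory.setLIntegral_congr_fun measurableSet_Icc h2, ofReal_norm, enorm_sub_rev]
  simp

/-- The segment gives the upper bound. For the lower one, the length of any C¹ curve is that of its
image in `E`, which is at least the distance between the endpoints. -/
theorem dist_eq (P Q : U) : h.smoothMetric.dist P Q = ENNReal.ofReal ‖lg P - lg Q‖ := by
  let _ : Bundle.RiemannianBundle (fun P : U => TangentSpace 𝓘(ℝ, E) P) :=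
      ⟨h.smoothMetric.toRiemannianMetric⟩
  refine le_antisymm ?_ ?_
  · rw [← h.length_segment]
    refine riemannianEDist_le_pathELength
      (((h.contMDiff_segment _ _).of_le (WithTop.coe_le_coe.2 le_top)).contMDiffOn) ?_ ?_ zero_le_one
    · exact Subtype.ext (by simp [segment, h.right_inv])
    · exact Subtype.ext (by simp [segment, h.right_inv])
  · refine le_of_forall_gt fun r hr => ?_
    obtain ⟨γ, h0, h1, hγ, hlt⟩ := exists_lt_of_riemannianEDist_lt hr
    refine lt_of_le_of_lt ?_ hlt
    change _ ≤ h.smoothMetric.length γ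
    rw [h.length_eq hγ, ← h0, ← h1, ofReal_norm, enorm_sub_rev]
    exact enorm_sub_le_lintegral_derivWithin_Icc_of_contDiffOn_Icc (h.contDiffOn_lg_comp hγ)
      zero_le_one

/-- Translations for the group operation transported from `E` are isometries. -/
theorem pullbackMetric_translation {φ : E → E} {z P : E} (hP : P ∈ U)
    (hφ : ∀ X, φ X = ex (lg X + z)) (u v : E) :
    pullbackMetric lg (φ P) (fderiv ℝ φ P u) (fderiv ℝ φ P v) = pullbackMetric lg P u v := by
  have h1 : HasFDerivAt φ (fderiv ℝ φ P) P := by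
    rw [funext hφ]
    exact ((h.hasFDerivAt_ex _).comp P ((h.hasFDerivAt hP).add_const z)).differentiableAt.hasFDerivAt
  have h2 : φ P ∈ U := by rw [hφ]; exact h.mem _
  have h3 := (h.hasFDerivAt h2).comp P h1
  -- In the chart φ is translation by z, so D lg(φ P) ∘ Dφ(P) = D lg(P).
  have h4 : lg ∘ φ = fun X => lg X + z := funext fun X => by
    rw [Function.comp_apply, hφ, h.left_inv]
  rw [h4] at h3
  have h5 := h3.unique ((h.hasFDerivAt hP).add_const z)
  rw [pullbackMetric_apply, pullbackMetric_apply, ← h5]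
  rfl

end FlatChart

end PullbackMetric

/-! ### Hilbert-Schmidt operators: ideal property and completeness -/

section HilbertSchmidtIdeal

variable {H : Type u} [NormedAddCommGroup H] [InnerProductSpace ℝ H]

theorem _root_.HilbertBasis.ext_inner {ι : Type*} (e : HilbertBasis ι ℝ H) {x y : H}
    (h : ∀ i, ⟪e i, x⟫ = ⟪e i, y⟫) : x = y := by
  apply e.repr.injective
  ext i
  rw [e.repr_apply_apply, e.repr_apply_apply, h]

theorem _root_.HilbertBasis.clm_ext {F : Type*} [NormedAddCommGroup F] [NormedSpace ℝ F]
    {ι : Type*} (e : HilbertBasis ι ℝ H) {S T : H →L[ℝ] F}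
    (h : ∀ i, S (e i) = T (e i)) : S = T := by
  ext x
  have h1 := (e.hasSum_repr x).mapL S
  have h2 := (e.hasSum_repr x).mapL T
  simp only [map_smul, h] at h1 h2
  exact h1.unique h2

theorem _root_.HilbertBasis.summable_inner_sq {ι : Type*} (e : HilbertBasis ι ℝ H) (x : H) :
    Summable fun i => ⟪e i, x⟫ ^ 2 :=
  (e.summable_inner_mul_inner x x).congr fun i => by rw [real_inner_comm (e i) x, sq]

theorem _root_.HilbertBasis.tsum_inner_sq {ι : Type*} (e : HilbertBasis ι ℝ H) (x : H) :
    ∑' i, ⟪e i, x⟫ ^ 2 = ‖x‖ ^ 2 := by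
  rw [← real_inner_self_eq_norm_sq, ← e.tsum_inner_mul_inner x x]
  exact tsum_congr fun i => by rw [real_inner_comm (e i) x, sq]

theorem IsHilbertSchmidt.comp_left {A : H →L[ℝ] H} (hA : IsHilbertSchmidt A) (T : H →L[ℝ] H) :
    IsHilbertSchmidt (T ∘L A) := fun ι e => by
  refine Summable.of_nonneg_of_le (fun i => sq_nonneg _) (fun i => ?_) ((hA e).mul_left (‖T‖ ^ 2))
  rw [← mul_pow]
  exact pow_le_pow_left₀ (norm_nonneg _) (T.le_opNorm _) 2

variable [CompleteSpace H]

theorem IsHilbertSchmidt.adjoint {A : H →L[ℝ] H} (hA : IsHilbertSchmidt A) :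
    IsHilbertSchmidt A.adjoint := fun ι e => by
  rw [summable_iff_enorm, ← tsum_enorm_sq_adjoint e e, ← summable_iff_enorm]
  exact hA e

theorem IsHilbertSchmidt.comp_right {A : H →L[ℝ] H} (hA : IsHilbertSchmidt A) (T : H →L[ℝ] H) :
    IsHilbertSchmidt (A ∘L T) := by
  have := (hA.adjoint.comp_left T.adjoint).adjoint
  rwa [ContinuousLinearMap.adjoint_comp, ContinuousLinearMap.adjoint_adjoint,
    ContinuousLinearMap.adjoint_adjoint] at this

/-- A Hilbert-Schmidt operator as an element of `HS H`. -/
def HS.ofOp (A : H →L[ℝ] H) (hA : IsHilbertSchmidt A) : HS H := ⟨A, hA⟩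

omit [CompleteSpace H] in
@[simp]
theorem HS.toOp_ofOp (A : H →L[ℝ] H) (hA : IsHilbertSchmidt A) : HS.toOp H (HS.ofOp A hA) = A := rfl

omit [CompleteSpace H] in
theorem HS.ext_toOp {A B : HS H} (h : HS.toOp H A = HS.toOp H B) : A = B := HS.toOp_injective H h

theorem HS.summable_norm_sq (A : HS H) {ι : Type*} (e : HilbertBasis ι ℝ H) :
    Summable fun i => ‖HS.toOp H A (e i)‖ ^ 2 :=
  summable_of_basis (stdBasis H) e (A.isHilbertSchmidt _)

theorem HS.norm_le_of_forall_norm_le {A B : HS H} {c : ℝ} (hc : 0 ≤ c) {ι : Type*}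
    (e : HilbertBasis ι ℝ H)
    (h : ∀ i, ‖HS.toOp H A (e i)‖ ≤ c * ‖HS.toOp H B (e i)‖) : ‖A‖ ≤ c * ‖B‖ := by
  refine (pow_le_pow_iff_left₀ (norm_nonneg _) (by positivity) two_ne_zero).1 ?_
  rw [mul_pow, HS.norm_sq_eq_tsum A e, HS.norm_sq_eq_tsum B e, ← tsum_mul_left]
  refine (A.summable_norm_sq e).tsum_le_tsum (fun i => ?_) ((B.summable_norm_sq e).mul_left _)
  rw [← mul_pow]
  exact pow_le_pow_left₀ (norm_nonneg _) (h i) 2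

theorem HS.norm_ofOp_adjoint (A : HS H) :
    ‖HS.ofOp (HS.toOp H A).adjoint A.isHilbertSchmidt.adjoint‖ = ‖A‖ := by
  refine (pow_left_inj₀ (norm_nonneg _) (norm_nonneg _) two_ne_zero).1 ?_
  rw [← ENNReal.ofReal_eq_ofReal_iff (sq_nonneg _) (sq_nonneg _)]
  have key : ∀ B : HS H, ENNReal.ofReal (‖B‖ ^ 2) = ∑' i, ‖HS.toOp H B (stdBasis H i)‖ₑ ^ 2 := by
    intro B
    rw [HS.norm_sq_eq_tsum B (stdBasis H), ENNReal.ofReal_tsum_of_nonneg (fun i => sq_nonneg _)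
      (B.summable_norm_sq _)]
    simp_rw [ENNReal.ofReal_pow (norm_nonneg _), ofReal_norm]
  rw [key, key, tsum_enorm_sq_adjoint (stdBasis H) (stdBasis H) (HS.toOp H A), HS.toOp_ofOp]

/-- The coordinates of A x are ⟪A* eᵢ, x⟫. Cauchy–Schwarz bounds each of them, and A* has the same
Hilbert-Schmidt norm as A. -/
theorem HS.norm_toOp_apply_le (A : HS H) (x : H) : ‖HS.toOp H A x‖ ≤ ‖A‖ * ‖x‖ := by
  refine (pow_le_pow_iff_left₀ (norm_nonneg _) (by positivity) two_ne_zero).1 ?_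
  rw [mul_pow, ← HS.norm_ofOp_adjoint, HS.norm_sq_eq_tsum _ (stdBasis H), mul_comm,
    ← (stdBasis H).tsum_inner_sq, ← tsum_mul_left]
  refine ((stdBasis H).summable_inner_sq _).tsum_le_tsum (fun i => ?_)
    ((HS.summable_norm_sq _ _).mul_left _)
  rw [HS.toOp_ofOp, ← ContinuousLinearMap.adjoint_inner_left, ← mul_pow, ← sq_abs, mul_comm]
  exact pow_le_pow_left₀ (abs_nonneg _) (abs_real_inner_le_norm _ _) 2

variable (H) in
/-- The inclusion of `HS(H)` in the bounded operators, as a continuous map. -/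
def HS.toOpL : HS H →L[ℝ] (H →L[ℝ] H) :=
  (HS.toOp H).mkContinuous 1 fun A =>
    (ContinuousLinearMap.opNorm_le_bound _ (norm_nonneg _) A.norm_toOp_apply_le).trans_eq
      (one_mul _).symm

variable (H) in
/-- Left multiplication of Hilbert-Schmidt operators by bounded operators. -/
def HS.mulLeft : (H →L[ℝ] H) →L[ℝ] HS H →L[ℝ] HS H :=
  LinearMap.mkContinuous₂
    (LinearMap.mk₂ ℝ (fun T A => HS.ofOp (T ∘L HS.toOp H A) (A.isHilbertSchmidt.comp_left T))
      (fun S T A => HS.ext_toOp (by simp))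
      (fun c T A => HS.ext_toOp (by simp))
      (fun T A B => HS.ext_toOp (by simp))
      (fun c T A => HS.ext_toOp (by simp))) 1 fun T A => by
    rw [one_mul]
    exact HS.norm_le_of_forall_norm_le (norm_nonneg _) (stdBasis H) fun i => T.le_opNorm _

variable (H) in
/-- Right multiplication of Hilbert-Schmidt operators by bounded operators. -/
def HS.mulRight : (H →L[ℝ] H) →L[ℝ] HS H →L[ℝ] HS H :=
  LinearMap.mkContinuous₂
    (LinearMap.mk₂ ℝ (fun T A => HS.ofOp (HS.toOp H A ∘L T) (A.isHilbertSchmidt.comp_right T))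
      (fun S T A => HS.ext_toOp (by simp))
      (fun c T A => HS.ext_toOp (by simp))
      (fun T A B => HS.ext_toOp (by simp))
      (fun c T A => HS.ext_toOp (by simp))) 1 fun T A => by
    rw [one_mul, ← HS.norm_ofOp_adjoint, ← HS.norm_ofOp_adjoint A,
      ← ContinuousLinearMap.adjoint.norm_map T]
    refine HS.norm_le_of_forall_norm_le (norm_nonneg _) (stdBasis H) fun i => ?_
    change ‖(HS.toOp H A ∘L T).adjoint _‖ ≤ _
    rw [ContinuousLinearMap.adjoint_comp]
    exact T.adjoint.le_opNorm _

@[simp]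
theorem HS.toOp_mulLeft (T : H →L[ℝ] H) (A : HS H) :
    HS.toOp H (HS.mulLeft H T A) = T ∘L HS.toOp H A := rfl

@[simp]
theorem HS.toOp_mulRight (T : H →L[ℝ] H) (A : HS H) :
    HS.toOp H (HS.mulRight H T A) = HS.toOp H A ∘L T := rfl

/-- An operator is prescribed by a square summable family of values on a Hilbert basis. -/
theorem HS.exists_toOp_apply_eq {ι : Type*} (e : HilbertBasis ι ℝ H) {f : ι → H}
    (hf : Summable fun i => ‖f i‖ ^ 2) : ∃ A : HS H, ∀ i, HS.toOp H A (e i) = f i := by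
  have hle : ∀ x i, ‖⟪e i, x⟫ • f i‖ ≤ (⟪e i, x⟫ ^ 2 + ‖f i‖ ^ 2) / 2 := fun x i => by
    rw [norm_smul, ← sq_abs, Real.norm_eq_abs]
    nlinarith [sq_nonneg (|⟪e i, x⟫| - ‖f i‖)]
  have hsb : ∀ x, Summable fun i => (⟪e i, x⟫ ^ 2 + ‖f i‖ ^ 2) / 2 := fun x =>
    ((e.summable_inner_sq x).add hf).div_const 2
  have hs : ∀ x, Summable fun i => ⟪e i, x⟫ • f i := fun x =>
    Summable.of_norm_bounded (hsb x) (hle x)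
  let T₀ : H →ₗ[ℝ] H :=
    { toFun := fun x => ∑' i, ⟪e i, x⟫ • f i
      map_add' := fun x y => by
        simp only [inner_add_right, add_smul]
        exact (hs x).tsum_add (hs y)
      map_smul' := fun c x => by
        simp only [inner_smul_right, mul_smul, RingHom.id_apply]
        exact (hs x).tsum_const_smul c }
  -- The termwise bound is not homogeneous in `x`; it is summed for ‖x‖ < 1 and linearity does the
  -- rest.
  have hb : ∃ C, ∀ x, ‖T₀ x‖ ≤ C * ‖x‖ := by
    refine LinearMap.bound_of_ball_bound one_pos ((1 + ∑' i, ‖f i‖ ^ 2) / 2) T₀ fun x hx => ?_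
    refine (tsum_of_norm_bounded (hsb x).hasSum (hle x)).trans ?_
    rw [tsum_div_const, (e.summable_inner_sq x).tsum_add hf, e.tsum_inner_sq]
    rw [mem_ball_zero_iff] at hx
    have : ‖x‖ ^ 2 ≤ 1 := pow_le_one₀ (norm_nonneg _) hx.le
    linarith
  let T : H →L[ℝ] H := T₀.mkContinuousOfExistsBound hb
  have hT : ∀ i, T (e i) = f i := fun i => by
    change ∑' j, ⟪e j, e i⟫ • f j = f i
    rw [tsum_eq_single i fun j hj => by rw [e.orthonormal.2 hj, zero_smul],
      real_inner_self_eq_norm_sq, e.orthonormal.1]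
    simp
  exact ⟨HS.ofOp T (.of_basis e (by simpa only [hT] using hf)), hT⟩

/-- Evaluation on a Hilbert basis is an isometry into the square summable families in `H`, and
`HS.exists_toOp_apply_eq` makes it surjective. -/
instance : CompleteSpace (HS H) := by
  set e := stdBasis H
  have hmem : ∀ A : HS H, Memℓp (fun i => HS.toOp H A (e i)) 2 := fun A => by
    rw [memℓp_gen_iff (by norm_num)]
    simpa using A.summable_norm_sq e
  let Φ : HS H →ₗᵢ[ℝ] lp (fun _ : (exists_hilbertBasis ℝ H).choose => H) 2 :=
    { toFun := fun A => ⟨fun i => HS.toOp H A (e i), hmem A⟩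
      map_add' := fun A B => by ext i; simp; rfl
      map_smul' := fun c A => by ext i; simp
      norm_map' := fun A => by
        refine (pow_left_inj₀ (norm_nonneg _) (norm_nonneg _) two_ne_zero).1 ?_
        rw [HS.norm_sq_eq_tsum A e]
        have := lp.norm_rpow_eq_tsum (p := 2) (by norm_num)
          (⟨fun i => HS.toOp H A (e i), hmem A⟩ :
            lp (fun _ : (exists_hilbertBasis ℝ H).choose => H) 2)
        simpa using this }
  have hΦ : Function.Surjective Φ := fun f => by
    obtain ⟨A, hA⟩ := HS.exists_toOp_apply_eq e (f := f) (by
      have := (memℓp_gen_iff (p := 2) (by norm_num)).1 f.2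
      simpa using this)
    exact ⟨A, by ext i; exact hA i⟩
  exact (completeSpace_congr (e := (LinearIsometryEquiv.ofSurjective Φ hΦ).toEquiv)
    (LinearIsometryEquiv.ofSurjective Φ hΦ).isometry.isUniformEmbedding).2 inferInstance

end HilbertSchmidtIdeal

/-! ### Exponentials through left multiplications -/

section LeftRegular

variable {F : Type*} [NormedAddCommGroup F] [NormedSpace ℝ F]

/-- The exponential for a bounded bilinear product `m` with right unit `e`, through the left
multiplications, which are elements of a Banach algebra. -/
def leftExp (m : F →L[ℝ] F →L[ℝ] F) (e x : F) : F := NormedSpace.exp (m x) e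

variable [CompleteSpace F]

theorem contDiff_leftExp (m : F →L[ℝ] F →L[ℝ] F) (e : F) : ContDiff ℝ ∞ (leftExp m e) := by
  have h1 : ContDiff ℝ ∞ (NormedSpace.exp : (F →L[ℝ] F) → F →L[ℝ] F) :=
    contDiff_iff_contDiffAt.2 fun x => (NormedSpace.exp_analytic (𝕂 := ℝ) x).contDiffAt
  exact (h1.comp m.contDiff).clm_apply contDiff_const

theorem hasFDerivAt_leftExp_zero {m : F →L[ℝ] F →L[ℝ] F} {e : F} (he : ∀ x, m x e = x) :
    HasFDerivAt (leftExp m e) (ContinuousLinearMap.id ℝ F) 0 := by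
  have h1 : HasFDerivAt (NormedSpace.exp : (F →L[ℝ] F) → F →L[ℝ] F)
      (1 : (F →L[ℝ] F) →L[ℝ] (F →L[ℝ] F)) (m 0) := by
    rw [map_zero]; exact hasFDerivAt_exp_zero
  have h2 := (h1.comp (0 : F) m.hasFDerivAt).clm_apply (hasFDerivAt_const e (0 : F))
  refine h2.congr_fderiv ?_
  ext x
  simp [he]

/-- Termwise in the exponential series, since ρ((m x)ⁿ e) = (ρ x)ⁿ. Multiplicativity of ρ suffices;
associativity of `m` plays no role. -/
theorem map_leftExp {A : Type*} [NormedRing A] [NormedAlgebra ℝ A] [CompleteSpace A]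
    {m : F →L[ℝ] F →L[ℝ] F} {e : F} (ρ : F →L[ℝ] A) (hρ : ∀ x y, ρ (m x y) = ρ x * ρ y)
    (he : ρ e = 1) (x : F) : ρ (leftExp m e x) = NormedSpace.exp (ρ x) := by
  have h1 := NormedSpace.exp_series_hasSum_exp' (𝕂 := ℝ) (m x)
  have h2 := ((h1.mapL (ContinuousLinearMap.apply ℝ F e)).mapL ρ)
  have h3 : ∀ n : ℕ, ρ ((m x ^ n) e) = ρ x ^ n := fun n => by
    induction n with
    | zero => simp [he]
    | succ n ih => rw [pow_succ', pow_succ', mul_apply_eq_comp, hρ, ih]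
  have h4 := NormedSpace.exp_series_hasSum_exp' (𝕂 := ℝ) (ρ x)
  simp only [ContinuousLinearMap.apply_apply, map_smul, h3] at h2
  exact h2.unique h4

end LeftRegular

/-! ### The product and the exponential on extended Hilbert-Schmidt operators -/

section Extended

variable {H : Type u} [NormedAddCommGroup H] [InnerProductSpace ℝ H] [CompleteSpace H]

theorem HSX.norm_fst_le (X : HSX H) : ‖X.fst‖ ≤ ‖X‖ := by
  refine (pow_le_pow_iff_left₀ (norm_nonneg _) (norm_nonneg _) two_ne_zero).1 ?_
  nlinarith [sq_nonneg ‖X.snd‖, WithLp.prod_norm_sq_eq_of_L2 X]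

theorem HSX.norm_snd_le (X : HSX H) : ‖X.snd‖ ≤ ‖X‖ := by
  refine (pow_le_pow_iff_left₀ (norm_nonneg _) (norm_nonneg _) two_ne_zero).1 ?_
  nlinarith [sq_nonneg ‖X.fst‖, WithLp.prod_norm_sq_eq_of_L2 X]

theorem HSX.norm_le (X : HSX H) : ‖X‖ ≤ ‖X.fst‖ + ‖X.snd‖ := by
  refine (pow_le_pow_iff_left₀ (norm_nonneg _) (by positivity) two_ne_zero).1 ?_
  nlinarith [norm_nonneg X.fst, norm_nonneg X.snd, WithLp.prod_norm_sq_eq_of_L2 X]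

omit [CompleteSpace H] in
theorem HSX.op_apply (X : HSX H) (x : H) : HSX.op H X x = HS.toOp H X.fst x + X.snd • x := by
  simp [HSX.op]

theorem HSX.norm_op_le (X : HSX H) : ‖HSX.op H X‖ ≤ 2 * ‖X‖ := by
  refine ContinuousLinearMap.opNorm_le_bound _ (by positivity) fun x => ?_
  rw [HSX.op_apply]
  refine (norm_add_le _ _).trans ?_
  have h1 := (X.fst.norm_toOp_apply_le x).trans
    (mul_le_mul_of_nonneg_right X.norm_fst_le (norm_nonneg x))
  have h2 : ‖X.snd • x‖ ≤ ‖X‖ * ‖x‖ := by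
    rw [norm_smul]
    exact mul_le_mul_of_nonneg_right X.norm_snd_le (norm_nonneg x)
  linarith

variable (H) in
/-- `A + γ I ↦ A + γ I` from extended Hilbert-Schmidt operators to bounded operators, as a continuous
map. -/
def HSX.opL : HSX H →L[ℝ] (H →L[ℝ] H) := (HSX.op H).mkContinuous 2 HSX.norm_op_le

theorem HSX.opL_apply (X : HSX H) : HSX.opL H X = HSX.op H X := rfl

variable (H) in
/-- The identity operator as an extended Hilbert-Schmidt operator. -/
def HSX.id : HSX H := WithLp.toLp 2 (0, 1)

omit [CompleteSpace H] in
@[simp]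
theorem HSX.op_id : HSX.op H (HSX.id H) = 1 := by simp [HSX.op, HSX.id]

variable (H) in
/-- Composition of extended Hilbert-Schmidt operators. -/
def HSX.mul : HSX H →L[ℝ] HSX H →L[ℝ] HSX H :=
  LinearMap.mkContinuous₂
    -- With X = A + γI and Y = B + μI, the product is X B + μ A + γμ I.
    (LinearMap.mk₂ ℝ (fun X Y => WithLp.toLp 2
        (HS.mulLeft H (HSX.opL H X) Y.fst + Y.snd • X.fst, X.snd * Y.snd))
      (fun X Y Z => by
        rw [← WithLp.toLp_add]
        congr 1
        ext1
        · simp; abel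
        · simp; ring)
      (fun c X Y => by
        rw [← WithLp.toLp_smul]
        congr 1
        ext1
        · simp [smul_comm c]
        · simp; ring)
      (fun X Y Z => by
        rw [← WithLp.toLp_add]
        congr 1
        ext1
        · simp [add_smul]; abel
        · simp; ring)
      (fun c X Y => by
        rw [← WithLp.toLp_smul]
        congr 1
        ext1
        · simp [mul_smul]
        · simp; ring)) 4 fun X Y => by
    -- The constant is 4 = 2 + 1 + 1: the operator norm of X is at most 2‖X‖, and the other two
    -- terms are bounded by ‖X‖ ‖Y‖.
    refine (HSX.norm_le _).trans ?_
    change ‖HS.mulLeft H (HSX.opL H X) Y.fst + Y.snd • X.fst‖ + ‖X.snd * Y.snd‖ ≤ _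
    have h1 : ‖HS.mulLeft H (HSX.opL H X) Y.fst‖ ≤ 2 * ‖X‖ * ‖Y‖ := by
      refine (HS.norm_le_of_forall_norm_le (norm_nonneg (HSX.op H X)) (stdBasis H) fun i =>
        (HSX.op H X).le_opNorm _).trans ?_
      exact mul_le_mul X.norm_op_le Y.norm_fst_le (norm_nonneg _) (by positivity)
    have h2 : ‖Y.snd • X.fst‖ ≤ ‖Y‖ * ‖X‖ := by
      rw [norm_smul]
      exact mul_le_mul Y.norm_snd_le X.norm_fst_le (norm_nonneg _) (norm_nonneg _)
    have h3 : ‖X.snd * Y.snd‖ ≤ ‖X‖ * ‖Y‖ := by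
      rw [norm_mul]
      exact mul_le_mul X.norm_snd_le Y.norm_snd_le (norm_nonneg _) (norm_nonneg _)
    have h4 := norm_add_le (HS.mulLeft H (HSX.opL H X) Y.fst) (Y.snd • X.fst)
    linarith

theorem HSX.mul_fst (X Y : HSX H) :
    (HSX.mul H X Y).fst = HS.mulLeft H (HSX.opL H X) Y.fst + Y.snd • X.fst := rfl

theorem HSX.mul_snd (X Y : HSX H) : (HSX.mul H X Y).snd = X.snd * Y.snd := rfl

theorem HSX.op_mul (X Y : HSX H) :
    HSX.op H (HSX.mul H X Y) = HSX.op H X * HSX.op H Y := by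
  ext x
  rw [mul_apply_eq_comp, HSX.op_apply, HSX.op_apply Y, HSX.mul_fst, HSX.mul_snd]
  simp [HSX.op_apply, HSX.opL_apply, mul_smul, add_assoc]
  abel

theorem HSX.mul_id (X : HSX H) : HSX.mul H X (HSX.id H) = X := by
  rw [← WithLp.ofLp_injective 2 |>.eq_iff]
  refine Prod.ext ?_ ?_
  · change HS.mulLeft H (HSX.opL H X) 0 + (1 : ℝ) • X.fst = X.fst
    simp
  · change X.snd * 1 = X.snd
    simp

/-- The exponential of extended Hilbert-Schmidt operators. -/
def HSX.exp (X : HSX H) : HSX H := leftExp (HSX.mul H) (HSX.id H) X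

theorem HSX.contDiff_exp : ContDiff ℝ ∞ (HSX.exp : HSX H → HSX H) := contDiff_leftExp _ _

theorem HSX.hasFDerivAt_exp_zero :
    HasFDerivAt (HSX.exp : HSX H → HSX H) (ContinuousLinearMap.id ℝ _) 0 :=
  hasFDerivAt_leftExp_zero HSX.mul_id

theorem HSX.op_exp (X : HSX H) : HSX.op H (HSX.exp X) = NormedSpace.exp (HSX.op H X) :=
  map_leftExp (HSX.opL H) HSX.op_mul HSX.op_id X

end Extended

/-! ### The self-adjoint model space and its exponential -/

section Symmetric

variable {H : Type u} [NormedAddCommGroup H] [InnerProductSpace ℝ H] [CompleteSpace H]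

theorem mem_symHSX {X : HSX H} : X ∈ SymHSX H ↔ IsSelfAdjoint (HSX.op H X) := Iff.rfl

theorem symOp_injective (hH : ¬ FiniteDimensional ℝ H) :
    Function.Injective (symOp : SymHSX H → H →L[ℝ] H) :=
  (HSX.op_injective H hH).comp Subtype.val_injective

instance : CompleteSpace (SymHSX H) := by
  have h1 : IsClosed (SymHSX H : Set (HSX H)) := by
    have h2 : Continuous fun X : HSX H => ContinuousLinearMap.adjoint (HSX.opL H X) :=
      ContinuousLinearMap.adjoint.continuous.comp (HSX.opL H).continuous
    exact isClosed_eq h2 (HSX.opL H).continuous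
  exact h1.completeSpace_coe

omit [CompleteSpace H] in
theorem isHilbertSchmidt_rankOne (a b : H) : IsHilbertSchmidt (InnerProductSpace.rankOne ℝ a b) :=
  fun ι e => by
    refine ((e.summable_inner_sq b).mul_right (‖a‖ ^ 2)).congr fun i => ?_
    rw [InnerProductSpace.rankOne_apply, norm_smul, mul_pow, Real.norm_eq_abs, sq_abs,
      real_inner_comm]

/-- Evaluation at a unit vector a maps onto `H`: the self-adjoint operator y ⊗ a + a ⊗ y − ⟪a, y⟫ a
⊗ a sends a to y. -/
theorem not_finiteDimensional_symHSX (hH : ¬ FiniteDimensional ℝ H) :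
    ¬ FiniteDimensional ℝ (SymHSX H) := fun hfin => by
  have : Nontrivial H := not_subsingleton_iff_nontrivial.1 fun _ => hH inferInstance
  obtain ⟨a, ha⟩ := exists_norm_eq H zero_le_one
  let ev : SymHSX H →ₗ[ℝ] H :=
    ((ContinuousLinearMap.apply ℝ H a).toLinearMap ∘ₗ HSX.op H) ∘ₗ (SymHSX H).subtype
  refine hH (Module.Finite.of_surjective ev fun y => ?_)
  let T : HS H := HS.ofOp _ (isHilbertSchmidt_rankOne y a) +
    HS.ofOp _ (isHilbertSchmidt_rankOne a y) - ⟪a, y⟫ • HS.ofOp _ (isHilbertSchmidt_rankOne a a)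
  have hT : HSX.op H (WithLp.toLp 2 (T, 0)) = InnerProductSpace.rankOne ℝ y a +
      InnerProductSpace.rankOne ℝ a y - ⟪a, y⟫ • InnerProductSpace.rankOne ℝ a a := by
    simp [HSX.op, T]
  refine ⟨⟨WithLp.toLp 2 (T, 0), ?_⟩, ?_⟩
  · rw [mem_symHSX, hT, ContinuousLinearMap.isSelfAdjoint_iff']
    simp [add_comm]
  · change HSX.op H (WithLp.toLp 2 (T, 0)) a = y
    rw [hT]
    simp [ha, real_inner_comm]

theorem HSX.exp_mem (L : SymHSX H) : HSX.exp (L : HSX H) ∈ SymHSX H := by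
  rw [mem_symHSX, HSX.op_exp]
  exact L.2.exp

theorem symOp_exp (L : SymHSX H) : symOp (exp L) = NormedSpace.exp (symOp L) := by
  have h : ∃ P : SymHSX H, (symOp P) = NormedSpace.exp (symOp L) :=
    ⟨⟨_, HSX.exp_mem L⟩, HSX.op_exp _⟩
  rw [exp, dif_pos h]
  exact h.choose_spec

theorem coe_exp (hH : ¬ FiniteDimensional ℝ H) (L : SymHSX H) :
    (exp L : HSX H) = HSX.exp (L : HSX H) :=
  HSX.op_injective H hH ((symOp_exp L).trans (HSX.op_exp _).symm)

theorem contDiff_exp (hH : ¬ FiniteDimensional ℝ H) :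
    ContDiff ℝ ∞ (exp : SymHSX H → SymHSX H) := by
  -- Composing with the orthogonal projection, which fixes the values of `exp`, turns smoothness
  -- into the ambient space into smoothness into the subspace.
  have h1 : (exp : SymHSX H → SymHSX H) =
      (SymHSX H).orthogonalProjectionOnto ∘ HSX.exp ∘ (SymHSX H).subtypeL := by
    funext L
    have := (SymHSX H).orthogonalProjectionOnto_mem_subspace_eq_self (exp L)
    rw [coe_exp hH] at this
    exact this.symm
  rw [h1]
  exact (SymHSX H).orthogonalProjectionOnto.contDiff.comp
    (HSX.contDiff_exp.comp (SymHSX H).subtypeL.contDiff)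

/-- With S = exp(T/2) self-adjoint, ⟪x, exp(T) x⟫ = ‖S x‖², and the bounded left inverse R =
exp(−T/2) of S bounds ‖S x‖ below by a multiple of ‖x‖. -/
theorem isPosDef_exp {T : H →L[ℝ] H} (hT : IsSelfAdjoint T) : IsPosDef (NormedSpace.exp T) := by
  let _ : NormedAlgebra ℚ (H →L[ℝ] H) := NormedAlgebra.restrictScalars ℚ ℝ _
  set S := NormedSpace.exp ((1 / 2 : ℝ) • T) with hS
  set R := NormedSpace.exp (-((1 / 2 : ℝ) • T)) with hR
  have hST : NormedSpace.exp T = S * S := by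
    rw [hS, ← NormedSpace.exp_add_of_commute (Commute.refl _), ← add_smul]
    norm_num
  have hRS : R * S = 1 := by
    rw [hS, hR, ← NormedSpace.exp_add_of_commute (Commute.refl ((1 / 2 : ℝ) • T)).neg_left, neg_add_cancel,
      NormedSpace.exp_zero]
  have hSa : IsSelfAdjoint S := (IsSelfAdjoint.smul (IsSelfAdjoint.all _) hT).exp
  refine ⟨((‖R‖ + 1) ^ 2)⁻¹, by positivity, fun x => ?_⟩
  have h1 : ⟪x, NormedSpace.exp T x⟫ = ‖S x‖ ^ 2 := by
    rw [hST, mul_apply_eq_comp, ← ContinuousLinearMap.adjoint_inner_left,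
      hSa.adjoint_eq, real_inner_self_eq_norm_sq]
  have h2 : ‖x‖ ≤ (‖R‖ + 1) * ‖S x‖ := by
    have h3 : x = R (S x) := by
      rw [← mul_apply_eq_comp, hRS, one_apply_eq_self]
    calc ‖x‖ = ‖R (S x)‖ := congrArg _ h3
      _ ≤ ‖R‖ * ‖S x‖ := R.le_opNorm _
      _ ≤ _ := by nlinarith [norm_nonneg (S x)]
  rw [h1, inv_mul_le_iff₀ (by positivity), ← mul_pow]
  exact pow_le_pow_left₀ (norm_nonneg _) h2 2

theorem exp_mem_PC2 (L : SymHSX H) : exp L ∈ PC2 H := by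
  change IsPosDef (symOp (exp L))
  rw [symOp_exp]
  exact isPosDef_exp L.2

theorem exp_apply_eigenvector {T : H →L[ℝ] H} {x : H} {l : ℝ} (hx : T x = l • x) :
    NormedSpace.exp T x = Real.exp l • x := by
  have h1 := (NormedSpace.exp_series_hasSum_exp' (𝕂 := ℝ) T).mapL
    (ContinuousLinearMap.apply ℝ H x)
  have h3 : ∀ n : ℕ, (T ^ n) x = l ^ n • x := fun n => by
    induction n with
    | zero => simp
    | succ n ih => rw [pow_succ, mul_apply_eq_comp, hx, map_smul, ih, smul_smul, pow_succ']
  have h2 := (NormedSpace.exp_series_hasSum_exp' (𝕂 := ℝ) l).smul_const x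
  rw [← Real.exp_eq_exp_ℝ] at h2
  simp only [ContinuousLinearMap.apply_apply, map_smul, h3, smul_smul] at h1
  exact h1.unique h2

end Symmetric

/-! ### Eigenbases and the principal logarithm -/

section Spectral

variable {H : Type u} [NormedAddCommGroup H] [InnerProductSpace ℝ H] [CompleteSpace H]

/-- The restrictions of A to finitely many basis vectors have finite rank. Their squared
Hilbert-Schmidt distance to A is a tail of ∑ ‖A eᵢ‖², so they converge to A, also in operator norm.
-/
theorem HS.isCompactOperator (A : HS H) : IsCompactOperator (HS.toOp H A) := by
  classical
  set e := stdBasis H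
  let F : Finset (exists_hilbertBasis ℝ H).choose → HS H := fun s =>
    ∑ i ∈ s, HS.ofOp _ (isHilbertSchmidt_rankOne (HS.toOp H A (e i)) (e i))
  have hFe : ∀ s j, HS.toOp H (F s) (e j) = if j ∈ s then HS.toOp H A (e j) else 0 := by
    intro s j
    simp only [F, map_sum, HS.toOp_ofOp, sum_apply, InnerProductSpace.rankOne_apply,
      orthonormal_iff_ite.1 e.orthonormal, ite_smul, one_smul, zero_smul, Finset.sum_ite_eq']
  have hA : HasSum (fun i => ‖HS.toOp H A (e i)‖ ^ 2) (‖A‖ ^ 2) := by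
    rw [HS.norm_sq_eq_tsum A e]
    exact (A.summable_norm_sq e).hasSum
  have hnorm : ∀ s, ‖A - F s‖ ^ 2 = ‖A‖ ^ 2 - ∑ i ∈ s, ‖HS.toOp H A (e i)‖ ^ 2 := by
    intro s
    have h1 : HasSum (fun i => if i ∈ s then ‖HS.toOp H A (e i)‖ ^ 2 else 0)
        (∑ i ∈ s, if i ∈ s then ‖HS.toOp H A (e i)‖ ^ 2 else 0) :=
      hasSum_sum_of_ne_finset_zero fun i hi => if_neg hi
    rw [Finset.sum_congr rfl fun i hi => if_pos hi] at h1
    rw [HS.norm_sq_eq_tsum _ e, ← (hA.sub h1).tsum_eq]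
    refine tsum_congr fun i => ?_
    rw [map_sub, sub_apply, hFe]
    split_ifs <;> simp
  have hlim : Filter.Tendsto F Filter.atTop (𝓝 A) := by
    rw [tendsto_iff_norm_sub_tendsto_zero]
    have h1 : Filter.Tendsto (fun s => ‖A - F s‖ ^ 2) Filter.atTop (𝓝 0) := by
      simp only [hnorm]
      rw [← sub_self (‖A‖ ^ 2)]
      exact tendsto_const_nhds.sub hA
    have h2 := (Real.continuous_sqrt.tendsto 0).comp h1
    rw [Real.sqrt_zero] at h2
    refine h2.congr fun s => ?_
    rw [Function.comp_apply, Real.sqrt_sq (norm_nonneg _), norm_sub_rev]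
  refine isCompactOperator_of_tendsto (F := fun s => HS.toOp H (F s)) (l := Filter.atTop)
    (((HS.toOpL H).continuous.tendsto A).comp hlim) (Filter.Eventually.of_forall fun s => ?_)
  simp only [F, map_sum, HS.toOp_ofOp]
  have h1 : ∀ a b : H, InnerProductSpace.rankOne ℝ a b ∈
      compactOperator (RingHom.id ℝ) H H := fun a b =>
    (isCompactOperator_of_locallyCompactSpace_dom (innerSL ℝ b)).clm_comp
      (ContinuousLinearMap.toSpanSingleton ℝ a)
  exact Submodule.sum_mem _ fun i _ => h1 _ _

/-- A self-adjoint Hilbert-Schmidt operator has a Hilbert basis of eigenvectors. -/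
theorem HS.exists_eigenbasis (A : HS H) (hA : IsSelfAdjoint (HS.toOp H A)) :
    ∃ (ι : Type u) (φ : HilbertBasis ι ℝ H) (a : ι → ℝ), ∀ k, HS.toOp H A (φ k) = a k • φ k := by
  set T := HS.toOp H A
  have hsymm : (T : H →ₗ[ℝ] H).IsSymmetric := hA.isSymmetric
  have hspec := ContinuousLinearMap.orthogonalComplement_iSup_eigenspaces_eq_bot
    A.isCompactOperator hsymm
  have hcl : ∀ μ : ℝ, IsClosed (Module.End.eigenspace (T : Module.End ℝ H) μ : Set H) := fun μ => by
    have : (Module.End.eigenspace (T : Module.End ℝ H) μ : Set H) = {x | T x = μ • x} := by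
      ext x
      simp
    rw [this]
    exact isClosed_eq T.continuous (continuous_const_smul μ)
  have : ∀ μ : ℝ, CompleteSpace (Module.End.eigenspace (T : Module.End ℝ H) μ) := fun μ =>
    (hcl μ).completeSpace_coe
  -- All real μ are admitted: 0 covers the kernel, and a μ that is not an eigenvalue contributes an
  -- empty basis.
  choose w b hb using fun μ : ℝ =>
    exists_hilbertBasis ℝ (Module.End.eigenspace (T : Module.End ℝ H) μ)
  have horth := hsymm.orthogonalFamily_eigenspaces.orthonormal_sigma_orthonormal
    (v_family := fun μ => b μ) (fun μ => (b μ).orthonormal)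
  refine ⟨_, HilbertBasis.mkOfOrthogonalEqBot horth ?_, fun k => k.1, fun k => ?_⟩
  · rw [eq_bot_iff, ← hspec]
    intro x hx
    rw [Submodule.mem_orthogonal'] at hx
    rw [← Submodule.iInf_orthogonal, Submodule.mem_iInf]
    intro μ
    rw [Submodule.mem_orthogonal']
    intro v hv
    have h1 := ((b μ).hasSum_repr ⟨v, hv⟩).mapL
      ((innerSL ℝ x) ∘L (Module.End.eigenspace (T : Module.End ℝ H) μ).subtypeL)
    refine h1.unique (hasSum_zero.congr_fun fun i => ?_)
    rw [map_smul]
    have := hx _ (Submodule.subset_span ⟨⟨μ, i⟩, rfl⟩)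
    simp at this ⊢
    exact Or.inr this
  · rw [HilbertBasis.coe_mkOfOrthogonalEqBot]
    exact Module.End.mem_eigenspace_iff.1 (b k.1 k.2).2

theorem _root_.HilbertBasis.isSelfAdjoint_of_eigenvectors {ι : Type*} (φ : HilbertBasis ι ℝ H)
    {T : H →L[ℝ] H} {a : ι → ℝ} (h : ∀ k, T (φ k) = a k • φ k) : IsSelfAdjoint T := by
  classical
  rw [ContinuousLinearMap.isSelfAdjoint_iff']
  refine φ.clm_ext fun j => φ.ext_inner fun i => ?_
  rw [ContinuousLinearMap.adjoint_inner_right, h, h, real_inner_smul_left, real_inner_smul_right,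
    orthonormal_iff_ite.1 φ.orthonormal]
  split_ifs with hij
  · rw [hij]
  · simp

/-- The principal logarithm of a symmetric operator is unique. -/
theorem IsPrincipalLog.unique {P L L' : H →L[ℝ] H} (hP : IsSelfAdjoint P)
    (h : IsPrincipalLog P L) (h' : IsPrincipalLog P L') : L = L' := by
  obtain ⟨ι, φ, l, hφ⟩ := h
  obtain ⟨κ, ψ, m, hψ⟩ := h'
  refine φ.clm_ext fun k => ψ.ext_inner fun j => ?_
  have hL' : ⟪ψ j, L' (φ k)⟫ = Real.log (m j) * ⟪ψ j, φ k⟫ := by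
    rw [← ContinuousLinearMap.adjoint_inner_left,
      (ψ.isSelfAdjoint_of_eigenvectors fun j => (hψ j).2.2).adjoint_eq, (hψ j).2.2,
      real_inner_smul_left]
  -- Since `P` is self-adjoint, eigenvectors of the two bases are orthogonal unless their
  -- eigenvalues, hence the logarithms of these, agree.
  have hPP : l k * ⟪ψ j, φ k⟫ = m j * ⟪ψ j, φ k⟫ := by
    rw [← real_inner_smul_right, ← (hφ k).2.1, ← ContinuousLinearMap.adjoint_inner_left,
      hP.adjoint_eq, (hψ j).2.1, real_inner_smul_left]
  rw [hL', (hφ k).2.2, real_inner_smul_right]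
  rcases eq_or_ne ⟪ψ j, φ k⟫ 0 with h0 | h0
  · rw [h0, mul_zero, mul_zero]
  · rw [mul_right_cancel₀ h0 hPP]

theorem isSelfAdjoint_toOp_fst (P : SymHSX H) : IsSelfAdjoint (HS.toOp H (P : HSX H).fst) := by
  have h1 : HS.toOp H (P : HSX H).fst = symOp P - (P : HSX H).snd • 1 := by
    simp [symOp, HSX.op]
  rw [h1]
  exact P.2.sub (.smul (.all _) (.one _))

/-- An eigenbasis of the Hilbert-Schmidt part diagonalizes L, because the scalar part only shifts
eigenvalues, and then it diagonalizes exp L. -/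
theorem isPrincipalLog_exp (L : SymHSX H) : IsPrincipalLog (symOp (exp L)) (symOp L) := by
  obtain ⟨ι, φ, a, hφ⟩ := HS.exists_eigenbasis _ (isSelfAdjoint_toOp_fst L)
  have hL : ∀ k, symOp L (φ k) = (a k + (L : HSX H).snd) • φ k := fun k => by
    rw [symOp, HSX.op_apply, hφ, add_smul]
  refine ⟨ι, φ, fun k => Real.exp (a k + (L : HSX H).snd), fun k => ⟨Real.exp_pos _, ?_, ?_⟩⟩
  · rw [symOp_exp, exp_apply_eigenvector (hL k)]
  · rw [Real.log_exp, hL]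

theorem log_eq_of_isPrincipalLog (hH : ¬ FiniteDimensional ℝ H) {P L : SymHSX H}
    (h : IsPrincipalLog (symOp P) (symOp L)) : log P = L := by
  have hex : ∃ L : SymHSX H, IsPrincipalLog (symOp P) (symOp L) := ⟨L, h⟩
  rw [log, dif_pos hex]
  exact symOp_injective hH (hex.choose_spec.unique P.2 h)

theorem log_exp (hH : ¬ FiniteDimensional ℝ H) (L : SymHSX H) : log (exp L) = L :=
  log_eq_of_isPrincipalLog hH (isPrincipalLog_exp L)

theorem exp_eq_of_isPrincipalLog (hH : ¬ FiniteDimensional ℝ H) {P L : SymHSX H}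
    (h : IsPrincipalLog (symOp P) (symOp L)) : exp L = P := by
  obtain ⟨ι, φ, l, hφ⟩ := h
  refine symOp_injective hH (φ.clm_ext fun k => ?_)
  rw [symOp_exp, exp_apply_eigenvector (hφ k).2.2, Real.exp_log (hφ k).1, (hφ k).2.1]

omit [CompleteSpace H] in
theorem _root_.HilbertBasis.infinite_of_not_finiteDimensional {ι : Type*}
    (hH : ¬ FiniteDimensional ℝ H) (e : HilbertBasis ι ℝ H) : Infinite ι := by
  by_contra hfin
  rw [not_infinite_iff_finite] at hfin
  have := Fintype.ofFinite ι
  exact hH e.toOrthonormalBasis.toBasis.finiteDimensional_of_finite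

/-- For X = A + γI and an infinite Hilbert basis, M ≤ ⟪eᵢ, X eᵢ⟫ ≤ ‖A eᵢ‖ + γ, and ‖A eᵢ‖ → 0 by
square summability. -/
theorem HSX.le_snd_of_forall_le_inner (hH : ¬ FiniteDimensional ℝ H) {X : HSX H} {M : ℝ}
    (h : ∀ x, M * ‖x‖ ^ 2 ≤ ⟪x, HSX.op H X x⟫) : M ≤ X.snd := by
  set e := stdBasis H
  have := e.infinite_of_not_finiteDimensional hH
  have h1 := (Real.continuous_sqrt.tendsto 0).comp
    (X.fst.summable_norm_sq e).tendsto_cofinite_zero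
  have h2 := h1.add_const X.snd
  rw [Real.sqrt_zero, zero_add] at h2
  refine ge_of_tendsto' h2 fun i => ?_
  have h3 := h (e i)
  have h4 := real_inner_le_norm (e i) (HS.toOp H X.fst (e i))
  rw [HSX.op_apply, inner_add_right, real_inner_smul_right, real_inner_self_eq_norm_sq,
    e.orthonormal.1] at h3
  rw [e.orthonormal.1] at h4
  rw [Function.comp_apply, Real.sqrt_sq (norm_nonneg _)]
  linarith

/-- For P = A + γI with A φₖ = aₖ φₖ, the logarithm is B + log(γ) I, where B has eigenvalues log(aₖ
+ γ) − log γ. These numbers are square summable because both arguments are at least M, log is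
1/M-Lipschitz there, and (aₖ) is square summable. -/
theorem exists_isPrincipalLog (hH : ¬ FiniteDimensional ℝ H) {P : SymHSX H} (hP : P ∈ PC2 H) :
    ∃ L : SymHSX H, IsPrincipalLog (symOp P) (symOp L) := by
  obtain ⟨M, hM, hPM⟩ : IsPosDef (symOp P) := hP
  set γ := (P : HSX H).snd
  obtain ⟨ι, φ, a, hφ⟩ := HS.exists_eigenbasis _ (isSelfAdjoint_toOp_fst P)
  have hPφ : ∀ k, symOp P (φ k) = (a k + γ) • φ k := fun k => by
    rw [symOp, HSX.op_apply, hφ, add_smul]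
  have hle : ∀ k, M ≤ a k + γ := fun k => by
    have := hPM (φ k)
    rwa [hPφ, real_inner_smul_right, real_inner_self_eq_norm_sq, φ.orthonormal.1, one_pow, mul_one,
      mul_one] at this
  have ha : Summable fun k => a k ^ 2 :=
    ((P : HSX H).fst.summable_norm_sq φ).congr fun k => by
      rw [hφ, norm_smul, φ.orthonormal.1, mul_one, Real.norm_eq_abs, sq_abs]
  have hγ : M ≤ γ := HSX.le_snd_of_forall_le_inner hH hPM
  -- From log s ≤ s − 1 at s = x / y.
  have hlog : ∀ x y : ℝ, M ≤ x → M ≤ y → Real.log x - Real.log y ≤ |x - y| / M := by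
    intro x y hx hy
    have hx0 := hM.trans_le hx
    have hy0 := hM.trans_le hy
    rw [← Real.log_div (by positivity) (by positivity)]
    refine (Real.log_le_sub_one_of_pos (by positivity)).trans ?_
    rw [div_sub_one (by positivity)]
    exact (div_le_div_of_nonneg_right (le_abs_self _) (by positivity)).trans
      (div_le_div_of_nonneg_left (abs_nonneg _) hM hy)
  have hb : ∀ k, |Real.log (a k + γ) - Real.log γ| ≤ |a k| / M := fun k => by
    rw [abs_sub_le_iff]
    have h1 := hlog _ _ (hle k) hγ
    have h2 := hlog _ _ hγ (hle k)
    rw [abs_sub_comm] at h2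
    rw [add_sub_cancel_right] at h1 h2
    exact ⟨h1, h2⟩
  obtain ⟨B, hB⟩ := HS.exists_toOp_apply_eq φ
    (f := fun k => (Real.log (a k + γ) - Real.log γ) • φ k) (by
      refine Summable.of_nonneg_of_le (fun k => sq_nonneg _) (fun k => ?_)
        (ha.mul_right ((1 / M) ^ 2))
      rw [norm_smul, φ.orthonormal.1, mul_one, Real.norm_eq_abs, ← sq_abs (a k), ← mul_pow,
        mul_one_div]
      exact pow_le_pow_left₀ (abs_nonneg _) (hb k) 2)
  have hL : ∀ k, HSX.op H (WithLp.toLp 2 (B, Real.log γ)) (φ k) = Real.log (a k + γ) • φ k :=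
    fun k => by
      rw [HSX.op_apply]
      change HS.toOp H B (φ k) + Real.log γ • φ k = _
      rw [hB, ← add_smul, sub_add_cancel]
  exact ⟨⟨_, φ.isSelfAdjoint_of_eigenvectors hL⟩, ι, φ, fun k => a k + γ, fun k =>
    ⟨hM.trans_le (hle k), hPφ k, hL k⟩⟩

theorem isPrincipalLog_log (hH : ¬ FiniteDimensional ℝ H) {P : SymHSX H} (hP : P ∈ PC2 H) :
    IsPrincipalLog (symOp P) (symOp (log P)) := by
  rw [log, dif_pos (exists_isPrincipalLog hH hP)]
  exact (exists_isPrincipalLog hH hP).choose_spec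

theorem exp_log (hH : ¬ FiniteDimensional ℝ H) {P : SymHSX H} (hP : P ∈ PC2 H) :
    exp (log P) = P :=
  exp_eq_of_isPrincipalLog hH (isPrincipalLog_log hH hP)

end Spectral

/-! ### The Lyapunov equation PV + VP = W -/

section Lyapunov

variable {H : Type u} [NormedAddCommGroup H] [InnerProductSpace ℝ H] [CompleteSpace H]

variable (H) in
/-- The adjoint, as an isometry of the Hilbert-Schmidt operators. -/
def HS.adj : HS H →ₗᵢ[ℝ] HS H where
  toFun A := HS.ofOp (HS.toOp H A).adjoint A.isHilbertSchmidt.adjoint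
  map_add' A B := HS.ext_toOp (by simp)
  map_smul' c A := HS.ext_toOp (by simp)
  norm_map' := HS.norm_ofOp_adjoint

@[simp]
theorem HS.toOp_adj (A : HS H) : HS.toOp H (HS.adj H A) = (HS.toOp H A).adjoint := rfl

theorem HS.adj_mulLeft (T : H →L[ℝ] H) (A : HS H) :
    HS.adj H (HS.mulLeft H T A) = HS.mulRight H T.adjoint (HS.adj H A) :=
  HS.ext_toOp (by simp [ContinuousLinearMap.adjoint_comp])

theorem HS.adj_mulRight (T : H →L[ℝ] H) (A : HS H) :
    HS.adj H (HS.mulRight H T A) = HS.mulLeft H T.adjoint (HS.adj H A) :=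
  HS.ext_toOp (by simp [ContinuousLinearMap.adjoint_comp])

theorem HS.le_inner_mulLeft {T : H →L[ℝ] H} {M : ℝ} (hM : ∀ x, M * ‖x‖ ^ 2 ≤ ⟪x, T x⟫) (A : HS H) :
    M * ‖A‖ ^ 2 ≤ ⟪A, HS.mulLeft H T A⟫ := by
  rw [HS.norm_sq_eq_tsum A (stdBasis H), HS.inner_def, ← tsum_mul_left]
  exact ((A.summable_norm_sq _).mul_left M).tsum_le_tsum (fun i => hM _)
    (summable_inner_of_sq (A.summable_norm_sq _) (HS.summable_norm_sq _ _))

/-- The adjoint is an isometry exchanging right multiplication by T with left multiplication by T* =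
T. -/
theorem HS.le_inner_mulRight {T : H →L[ℝ] H} (hT : IsSelfAdjoint T) {M : ℝ}
    (hM : ∀ x, M * ‖x‖ ^ 2 ≤ ⟪x, T x⟫) (A : HS H) :
    M * ‖A‖ ^ 2 ≤ ⟪A, HS.mulRight H T A⟫ := by
  rw [← (HS.adj H).inner_map_map, HS.adj_mulRight, hT.adjoint_eq, ← (HS.adj H).norm_map]
  exact HS.le_inner_mulLeft hM _

/-- The Lyapunov operator `A ↦ T A + A T` of a positive definite operator is bijective on the
Hilbert-Schmidt operators. -/
theorem HS.bijective_mulLeft_add_mulRight {T : H →L[ℝ] H} (hT : IsSelfAdjoint T)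
    (hpos : IsPosDef T) : Function.Bijective (HS.mulLeft H T + HS.mulRight H T) := by
  obtain ⟨M, hM, hTM⟩ := hpos
  set Λ := HS.mulLeft H T + HS.mulRight H T
  -- Lax–Milgram: each of the two multiplications contributes M ‖A‖² to the quadratic form.
  have hco : IsCoercive ((innerSL ℝ) ∘L Λ : HS H →L[ℝ] HS H →L[ℝ] ℝ) := by
    refine ⟨2 * M, by positivity, fun A => ?_⟩
    change 2 * M * ‖A‖ * ‖A‖ ≤ ⟪HS.mulLeft H T A + HS.mulRight H T A, A⟫
    rw [real_inner_comm, inner_add_right]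
    have h1 := HS.le_inner_mulLeft hTM A
    have h2 := HS.le_inner_mulRight hT hTM A
    linarith
  have h : ⇑hco.continuousLinearEquivOfBilin = Λ := by
    funext A
    exact (hco.unique_continuousLinearEquivOfBilin fun B => rfl).symm
  rw [← h]
  exact hco.continuousLinearEquivOfBilin.bijective

omit [CompleteSpace H] in
theorem HSX.ext_fst_snd {X Y : HSX H} (h1 : X.fst = Y.fst) (h2 : X.snd = Y.snd) : X = Y :=
  WithLp.ofLp_injective 2 (Prod.ext h1 h2)

/-- The scalar part ν of V commutes with X and contributes 2νX. With `HSX.mul_add_mul_snd` the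
equation XV + VX = W is thus triangular: the scalar part of V is found first, and a Lyapunov
equation in `HS H` remains. -/
theorem HSX.mul_add_mul_fst (X V : HSX H) : (HSX.mul H X V + HSX.mul H V X).fst =
    (HS.mulLeft H (HSX.op H X) + HS.mulRight H (HSX.op H X)) V.fst + (2 * V.snd) • X.fst := by
  rw [WithLp.add_fst, HSX.mul_fst, HSX.mul_fst]
  refine HS.ext_toOp ?_
  ext x
  simp [HSX.opL_apply, HSX.op_apply, two_mul, add_smul]
  abel

theorem HSX.mul_add_mul_snd (X V : HSX H) :
    (HSX.mul H X V + HSX.mul H V X).snd = 2 * X.snd * V.snd := by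
  rw [WithLp.add_snd, HSX.mul_snd, HSX.mul_snd]
  ring

theorem HSX.mul_add_mul_injective (hH : ¬ FiniteDimensional ℝ H) {P : SymHSX H} (hP : P ∈ PC2 H)
    {V : HSX H} (hV : HSX.mul H P V + HSX.mul H V P = 0) : V = 0 := by
  have hP' : IsPosDef (symOp P) := hP
  obtain ⟨M, hM, hPM⟩ := hP'
  have hβ := hM.trans_le (HSX.le_snd_of_forall_le_inner hH hPM)
  have h1 := HSX.mul_add_mul_fst (P : HSX H) V
  have h2 := HSX.mul_add_mul_snd (P : HSX H) V
  rw [hV] at h1 h2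
  have h3 : V.snd = 0 := by
    rw [WithLp.zero_snd, eq_comm] at h2
    simpa [hβ.ne'] using h2
  rw [h3, mul_zero, zero_smul, add_zero, WithLp.zero_fst] at h1
  have h4 : V.fst = 0 := (HS.bijective_mulLeft_add_mulRight P.2 hP).1 (h1.symm.trans (map_zero _).symm)
  exact HSX.ext_fst_snd h4 h3

theorem HSX.exists_mul_add_mul_eq (hH : ¬ FiniteDimensional ℝ H) {P : SymHSX H} (hP : P ∈ PC2 H)
    (W : SymHSX H) : ∃ V : SymHSX H, HSX.mul H P V + HSX.mul H V P = W := by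
  have hP' : IsPosDef (symOp P) := hP
  obtain ⟨M, hM, hPM⟩ := hP'
  have hβ := hM.trans_le (HSX.le_snd_of_forall_le_inner hH hPM)
  set β := (P : HSX H).snd
  set γ := (W : HSX H).snd / (2 * β) with hγ
  set C := (W : HSX H).fst - (2 * γ) • (P : HSX H).fst with hC
  have hbij := HS.bijective_mulLeft_add_mulRight P.2 hP
  obtain ⟨A, hA⟩ := hbij.2 C
  have hadj : ∀ Q : SymHSX H, HS.adj H (Q : HSX H).fst = (Q : HSX H).fst := fun Q =>
    HS.ext_toOp (isSelfAdjoint_toOp_fst Q).adjoint_eq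
  -- P and C are self-adjoint, so A* solves the same Lyapunov equation as A and equals it by
  -- uniqueness.
  have hAA : HS.adj H A = A := by
    apply hbij.1
    have h1 := congrArg (HS.adj H) hA
    rw [hC, map_sub, map_smul, hadj, hadj, ← hC, ← hA, add_apply, map_add, HS.adj_mulLeft,
      HS.adj_mulRight, P.2.adjoint_eq, add_comm] at h1
    exact h1
  have hAsa : IsSelfAdjoint (HS.toOp H A) :=
    ContinuousLinearMap.isSelfAdjoint_iff'.2 (congrArg (HS.toOp H) hAA)
  refine ⟨⟨WithLp.toLp 2 (A, γ), ?_⟩, HSX.ext_fst_snd ?_ ?_⟩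
  · exact hAsa.add (.smul (.all _) (.one _))
  · rw [HSX.mul_add_mul_fst]
    change (HS.mulLeft H (symOp P) + HS.mulRight H (symOp P)) A + (2 * γ) • _ = _
    rw [show (HS.mulLeft H (symOp P) + HS.mulRight H (symOp P)) A = C from hA, hC, sub_add_cancel]
  · rw [HSX.mul_add_mul_snd]
    change 2 * β * γ = _
    rw [hγ]
    field_simp

end Lyapunov

/-! ### Smoothness of the logarithm -/

section Smoothness

variable {H : Type u} [NormedAddCommGroup H] [InnerProductSpace ℝ H] [CompleteSpace H]

theorem hasFDerivAt_exp (hH : ¬ FiniteDimensional ℝ H) (L : SymHSX H) :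
    HasFDerivAt (exp : SymHSX H → SymHSX H) (fderiv ℝ exp L) L :=
  ((contDiff_exp hH).differentiable (by simp) L).hasFDerivAt

theorem fderiv_exp_zero (hH : ¬ FiniteDimensional ℝ H) :
    fderiv ℝ (exp : SymHSX H → SymHSX H) 0 = ContinuousLinearMap.id ℝ _ := by
  have h1 := (SymHSX H).subtypeL.hasFDerivAt.comp (0 : SymHSX H) (hasFDerivAt_exp hH 0)
  have h2 : HasFDerivAt (HSX.exp : HSX H → HSX H) (ContinuousLinearMap.id ℝ _)
      ((SymHSX H).subtypeL 0) := by
    rw [map_zero]; exact HSX.hasFDerivAt_exp_zero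
  have h3 := h2.comp (0 : SymHSX H) (SymHSX H).subtypeL.hasFDerivAt
  have h4 : (SymHSX H).subtypeL ∘ (exp : SymHSX H → SymHSX H) =
      HSX.exp ∘ (SymHSX H).subtypeL := funext fun L => coe_exp hH L
  rw [h4] at h1
  ext1 U
  exact Subtype.ext (DFunLike.congr_fun (h1.unique h3) U)

theorem coe_exp_two_smul (hH : ¬ FiniteDimensional ℝ H) (L : SymHSX H) :
    (exp ((2 : ℝ) • L) : HSX H) = HSX.mul H (exp L) (exp L) := by
  let _ : NormedAlgebra ℚ (H →L[ℝ] H) := NormedAlgebra.restrictScalars ℚ ℝ _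
  apply HSX.op_injective H hH
  rw [HSX.op_mul]
  change symOp _ = symOp _ * symOp _
  rw [symOp_exp, symOp_exp, ← NormedSpace.exp_add_of_commute (Commute.refl (symOp L)), two_smul]
  congr 1
  exact map_add ((HSX.op H) ∘ₗ (SymHSX H).subtype) L L

theorem fderiv_exp_two_smul (hH : ¬ FiniteDimensional ℝ H) (L U : SymHSX H) :
    (fderiv ℝ exp ((2 : ℝ) • L) ((2 : ℝ) • U) : HSX H) =
      HSX.mul H (exp L) (fderiv ℝ exp L U) + HSX.mul H (fderiv ℝ exp L U) (exp L) := by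
  have h1 : HasFDerivAt (fun L : SymHSX H => exp ((2 : ℝ) • L))
      (fderiv ℝ exp ((2 : ℝ) • L) ∘L ((2 : ℝ) • ContinuousLinearMap.id ℝ _)) L :=
    (hasFDerivAt_exp hH _).comp L ((hasFDerivAt_id L).const_smul (2 : ℝ))
  have h2 := (SymHSX H).subtypeL.hasFDerivAt.comp L h1
  have h3 := (SymHSX H).subtypeL.hasFDerivAt.comp L (hasFDerivAt_exp hH L)
  have h4 := (HSX.mul H).hasFDerivAt_of_bilinear h3 h3
  have h5 := h2.unique (h4.congr_of_eventuallyEq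
    (Filter.Eventually.of_forall fun L => coe_exp_two_smul hH L))
  exact DFunLike.congr_fun h5 U

/-- By `fderiv_exp_two_smul`, D exp(2L) is, up to the factor 2, D exp(L) followed by the Lyapunov
operator of exp L, which is bijective on the self-adjoint elements. -/
theorem bijective_fderiv_exp_two_smul (hH : ¬ FiniteDimensional ℝ H) {L : SymHSX H}
    (hL : Function.Bijective (fderiv ℝ exp L)) :
    Function.Bijective (fderiv ℝ exp ((2 : ℝ) • L)) := by
  have hhalf : ∀ U : SymHSX H, (2 : ℝ) • (1 / 2 : ℝ) • U = U := fun U => by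
    rw [smul_smul]; norm_num
  refine ⟨(injective_iff_map_eq_zero _).2 fun U hU => ?_, fun W => ?_⟩
  · have h1 := fderiv_exp_two_smul hH L ((1 / 2 : ℝ) • U)
    rw [hhalf, hU] at h1
    have h2 := HSX.mul_add_mul_injective hH (exp_mem_PC2 L) h1.symm
    have h3 : (1 / 2 : ℝ) • U = 0 := hL.1 ((Subtype.ext h2).trans (map_zero _).symm)
    rw [← hhalf U, h3, smul_zero]
  · obtain ⟨V, hV⟩ := HSX.exists_mul_add_mul_eq hH (exp_mem_PC2 L) W
    obtain ⟨U, rfl⟩ := hL.2 V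
    exact ⟨(2 : ℝ) • U, Subtype.ext ((fderiv_exp_two_smul hH L U).trans hV)⟩

/-- D exp is the identity at 0 and continuous, and invertible operators form an open set, so it is
bijective at L / 2ⁿ for some n. Then n doublings lead back to L. -/
theorem bijective_fderiv_exp (hH : ¬ FiniteDimensional ℝ H) (L : SymHSX H) :
    Function.Bijective (fderiv ℝ (exp : SymHSX H → SymHSX H) L) := by
  have h1 : ∀ᶠ Y in 𝓝 (0 : SymHSX H), Function.Bijective (fderiv ℝ exp Y) := by
    have hc : Continuous (fderiv ℝ (exp : SymHSX H → SymHSX H)) :=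
      (contDiff_exp hH).continuous_fderiv (by simp)
    have h2 := ContinuousLinearEquiv.nhds (ContinuousLinearEquiv.refl ℝ (SymHSX H))
    have h3 : Filter.Tendsto (fderiv ℝ (exp : SymHSX H → SymHSX H)) (𝓝 0)
        (𝓝 ((ContinuousLinearEquiv.refl ℝ (SymHSX H)) : SymHSX H →L[ℝ] SymHSX H)) := by
      have := hc.tendsto 0
      rwa [fderiv_exp_zero hH] at this
    filter_upwards [h3 h2] with Y ⟨e, he⟩
    rw [← he]
    exact e.bijective
  have h2 : Filter.Tendsto (fun n : ℕ => (1 / 2 : ℝ) ^ n • L) Filter.atTop (𝓝 0) := by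
    have := (tendsto_pow_atTop_nhds_zero_of_lt_one (r := (1 / 2 : ℝ)) (by norm_num)
      (by norm_num)).smul_const L
    rwa [zero_smul] at this
  obtain ⟨n, hn⟩ := (h2.eventually h1).exists
  have h3 : ∀ n : ℕ, Function.Bijective (fderiv ℝ exp ((1 / 2 : ℝ) ^ n • L)) →
      Function.Bijective (fderiv ℝ exp L) := by
    intro n
    induction n with
    | zero => intro h; rwa [pow_zero, one_smul] at h
    | succ n ih =>
      intro h
      apply ih
      have := bijective_fderiv_exp_two_smul hH h
      rwa [smul_smul, pow_succ', ← mul_assoc, mul_one_div_cancel two_ne_zero, one_mul] at this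
  exact h3 n hn

theorem contDiffAt_log (hH : ¬ FiniteDimensional ℝ H) {P : SymHSX H} (hP : P ∈ PC2 H) :
    ContDiffAt ℝ ∞ (log : SymHSX H → SymHSX H) P := by
  set L := log P with hL
  have hPL : exp L = P := exp_log hH hP
  have hb := bijective_fderiv_exp hH L
  let e : SymHSX H ≃L[ℝ] SymHSX H := ContinuousLinearEquiv.ofBijective (fderiv ℝ exp L)
    (LinearMap.ker_eq_bot.2 hb.1) (LinearMap.range_eq_top.2 hb.2)
  have hd : HasFDerivAt (exp : SymHSX H → SymHSX H) (e : SymHSX H →L[ℝ] SymHSX H) L :=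
    hasFDerivAt_exp hH L
  have hc := (contDiff_exp hH).contDiffAt (x := L)
  have h1 := hc.to_localInverse hd (by simp)
  rw [hPL] at h1
  refine h1.congr_of_eventuallyEq ?_
  have h2 := (hc.hasStrictFDerivAt' hd (by simp)).eventually_right_inverse
  rw [hPL] at h2
  -- The local inverse f satisfies exp(f Q) = Q near P, hence f Q = log(exp(f Q)) = log Q.
  filter_upwards [h2] with Q hQ
  exact (congrArg log hQ).symm.trans (log_exp hH _)

/-- The principal logarithm is a global chart of `PC₂(H)` with inverse `exp`. -/
theorem flatChart (hH : ¬ FiniteDimensional ℝ H) : FlatChart (PC2 H) log exp where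
  contDiffOn _ hP := (contDiffAt_log hH hP).contDiffWithinAt
  contDiff := contDiff_exp hH
  mem := exp_mem_PC2
  left_inv := log_exp hH
  right_inv _ hP := exp_log hH hP

theorem exp_zero (hH : ¬ FiniteDimensional ℝ H) : exp (0 : SymHSX H) = PC2.id H := by
  apply symOp_injective hH
  rw [symOp_exp]
  have h1 : symOp (0 : SymHSX H) = 0 := map_zero (HSX.op H)
  rw [h1, NormedSpace.exp_zero]
  exact HSX.op_id.symm

theorem fderiv_log_id (hH : ¬ FiniteDimensional ℝ H) (U : SymHSX H) :
    fderiv ℝ log (PC2.id H : SymHSX H) U = U := by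
  have h1 := (flatChart hH).fderiv_lg_fderiv_ex (PC2.id H).2 U
  rw [← exp_zero hH] at h1 ⊢
  rwa [log_exp hH, fderiv_exp_zero hH] at h1

end Smoothness

end LogHS

end

/-! ### The Log-Hilbert-Schmidt metric on PC₂(H) -/

theorem theorem3p5 {H : Type u} [NormedAddCommGroup H] [InnerProductSpace ℝ H] [CompleteSpace H]
    [TopologicalSpace.SeparableSpace H] (hH : ¬ FiniteDimensional ℝ H) :
    -- the model space is an infinite-dimensional Hilbert space, on which `log` and `exp` are
    -- the principal logarithm and the operator exponential
    CompleteSpace (LogHS.SymHSX H) ∧ ¬ FiniteDimensional ℝ (LogHS.SymHSX H) ∧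
    (∀ P ∈ LogHS.PC2 H, LogHS.IsPrincipalLog (LogHS.symOp P) (LogHS.symOp (LogHS.log P)) ∧
      DifferentiableAt ℝ LogHS.log P) ∧
    (∀ L : LogHS.SymHSX H, LogHS.exp L ∈ LogHS.PC2 H ∧
      LogHS.symOp (LogHS.exp L) = NormedSpace.exp (LogHS.symOp L)) ∧
    -- `g` is bi-invariant for `⊙` and is the extended Hilbert-Schmidt inner product at `I`
    (∀ U V : LogHS.SymHSX H, LogHS.logHSMetric H (LogHS.PC2.id H) U V = ⟪U, V⟫) ∧
    (∀ P ∈ LogHS.PC2 H, ∀ Q ∈ LogHS.PC2 H, ∀ U V : LogHS.SymHSX H,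
      LogHS.logHSMetric H (LogHS.odot Q P)
          (fderiv ℝ (fun X => LogHS.odot Q X) P U) (fderiv ℝ (fun X => LogHS.odot Q X) P V) =
        LogHS.logHSMetric H P U V ∧
      LogHS.logHSMetric H (LogHS.odot P Q)
          (fderiv ℝ (fun X => LogHS.odot X Q) P U) (fderiv ℝ (fun X => LogHS.odot X Q) P V) =
        LogHS.logHSMetric H P U V) ∧
    -- `g` is a smooth Riemannian metric on `PC₂(H)`
    ∃ G : LogHS.SmoothMetric (LogHS.PC2 H),
      (∀ (P : LogHS.PC2 H) (U V : LogHS.SymHSX H), G.inner P U V = LogHS.logHSMetric H P U V) ∧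
      -- it has a Levi-Civita connection, and this is flat
      ∃ Γ : LogHS.SymHSX H → LogHS.SymHSX H →L[ℝ] LogHS.SymHSX H →L[ℝ] LogHS.SymHSX H,
        LogHS.IsLeviCivita (LogHS.PC2 H) (LogHS.logHSMetric H) Γ ∧
        (∀ P ∈ LogHS.PC2 H, ∀ u v w, LogHS.curvature Γ P u v w = 0) ∧
        (∀ P ∈ LogHS.PC2 H, ∀ u v, LinearIndependent ℝ ![u, v] →
          LogHS.sectionalCurvature (LogHS.logHSMetric H) Γ P u v = 0) ∧
        -- geodesics and distance
        ∀ P Q : LogHS.PC2 H, ∃ c : ℝ → LogHS.PC2 H,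
          (∀ t, (c t : LogHS.SymHSX H) =
            LogHS.exp ((1 - t) • LogHS.log P + t • LogHS.log Q)) ∧
          c 0 = P ∧ c 1 = Q ∧ LogHS.IsGeodesic Γ (fun t => (c t : LogHS.SymHSX H)) ∧
          (∀ c' : ℝ → LogHS.PC2 H, c' 0 = P → c' 1 = Q →
            LogHS.IsGeodesic Γ (fun t => (c' t : LogHS.SymHSX H)) → EqOn c' c (Icc 0 1)) ∧
          G.dist P Q = G.length c ∧
          G.dist P Q =
            ENNReal.ofReal ‖LogHS.log (P : LogHS.SymHSX H) - LogHS.log (Q : LogHS.SymHSX H)‖ := by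
  -- `logHSMetric H` is by definition `pullbackMetric` of `log`, so the results on flat charts apply
  -- as they stand.
  have h := LogHS.flatChart hH
  refine ⟨inferInstance, LogHS.not_finiteDimensional_symHSX hH, fun P hP =>
    ⟨LogHS.isPrincipalLog_log hH hP, (h.hasFDerivAt hP).differentiableAt⟩,
    fun L => ⟨LogHS.exp_mem_PC2 L, LogHS.symOp_exp L⟩, fun U V => ?_, fun P hP Q hQ U V => ?_,
    h.smoothMetric, fun P U V => rfl, LogHS.pullbackChristoffel LogHS.log LogHS.exp,
    h.isLeviCivita, fun P hP u v w => h.curvature_eq_zero hP u v w, fun P hP u v huv => ?_,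
    fun P Q => ?_⟩
  · change ⟪fderiv ℝ LogHS.log _ U, fderiv ℝ LogHS.log _ V⟫ = ⟪U, V⟫
    rw [LogHS.fderiv_log_id hH, LogHS.fderiv_log_id hH]
  · exact ⟨h.pullbackMetric_translation (φ := fun X => LogHS.odot Q X) (z := LogHS.log Q) hP
        (fun X => by rw [LogHS.odot, add_comm]) U V,
      h.pullbackMetric_translation (φ := fun X => LogHS.odot X Q) (z := LogHS.log Q) hP
        (fun X => rfl) U V⟩
  · rw [LogHS.sectionalCurvature, h.curvature_eq_zero hP]
    simp
  · have h0 : h.segment (LogHS.log P) (LogHS.log Q) 0 = P :=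
      Subtype.ext (by simp [LogHS.FlatChart.segment, h.right_inv])
    have h1 : h.segment (LogHS.log P) (LogHS.log Q) 1 = Q :=
      Subtype.ext (by simp [LogHS.FlatChart.segment, h.right_inv])
    refine ⟨h.segment (LogHS.log P) (LogHS.log Q), fun t => rfl, h0, h1,
      h.isGeodesic_segment _ _, fun c' hc0 hc1 hc' t ht => Subtype.ext ?_, ?_, h.dist_eq P Q⟩
    · have := h.eqOn_segment_of_isGeodesic (fun t _ => (c' t).2) hc' t ht
      rwa [hc0, hc1] at this
    · rw [h.dist_eq, h.length_segment]
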